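/- Let $k$ be a field and let $R=\bigoplus_{i\ge 0}R_i$ be a commutative, finitely generated, graded $k$-algebra with $R_0=k$ (generators of arbitrary positive degrees are allowed). Let $M,N$ be nonzero finitely generated $\mathbb Z$-graded $R$-modules. Write $\dim$ for Krull dimension ($\dim M$ being the dimension of the support of $M$) and $\operatorname{HS}_V(t)=\sum_{j\in\mathbb Z}(\dim_k V_j)\,t^j$ for the Hilbert series of a graded vector space $V$. Give $\operatorname{Tor}_i(M,N)=\operatorname{Tor}_i^R(M,N)$ its natural grading, i.e. that of the $i$-th homology of $F_\bullet\otimes_R N$ for a graded free resolution $F_\bullet$ of $M$. Then $\dim M$, $\dim N$ and $\dim R$ are finite; each $\operatorname{Tor}_i(M,N)_j$ is finite dimensional over $k$; for each $j$, $\operatorname{Tor}_i(M,N)_j\neq 0$ for only finitely many $i$; and there is $b\in\mathbb Z$ with $\operatorname{Tor}_i(M,N)_j=0$ for all $i$ and all $j<b$. Hence \[ \chi(M,N)(t):=\sum_{i\ge 0}(-1)^i\operatorname{HS}_{\operatorname{Tor}_i(M,N)}(t) \] is a well-defined formal Laurent series with integer coefficients. Moreover there is a rational function $e_{M,N}(t)\in\mathbb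 Q(t)$, defined at $t=1$, with $e_{M,N}(1)\in\mathbb Q_{>0}$, such that $\chi(M,N)(t)$ is the Laurent expansion at $t=0$ of \[ \frac{1}{(1-t)^{\dim M+\dim N-\dim R}}\cdot e_{M,N}(t). \] -/

import Mathlib

open scoped TensorProduct

universe w

noncomputable section

section GradedModules

variable {k R M N : Type*} [Field k] [CommRing R] [Algebra k R]
  [AddCommGroup M] [Module k M] [Module R M]
  [AddCommGroup N] [Module k N] [Module R N]

/-- `ℳ` is a `ℤ`-grading of the `R`-module `M`, where `R` is `ℕ`-graded by `𝒜`: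
`M` is the internal direct sum of the `k`-subspaces `ℳ j`, and `𝒜 i • ℳ j ⊆ ℳ (i + j)`. -/
structure IsGradedModule (𝒜 : ℕ → Submodule k R) (ℳ : ℤ → Submodule k M) : Prop where
  isInternal : DirectSum.IsInternal ℳ
  smul_mem : ∀ {i : ℕ} {j : ℤ} {a : R} {m : M}, a ∈ 𝒜 i → m ∈ ℳ j → a • m ∈ ℳ (i + j)

/-- The grading of `M ⊗[R] N` induced by gradings of `M` and `N`: the degree `j` part is
spanned over `k` by the `m ⊗ n` with `m`, `n` homogeneous and `deg m + deg n = j`. -/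
def tensorGrading (R : Type*) {M N : Type*} [CommRing R] [Algebra k R]
    [AddCommGroup M] [Module k M] [Module R M] [IsScalarTower k R M]
    [AddCommGroup N] [Module k N] [Module R N]
    (ℳ : ℤ → Submodule k M) (𝒩 : ℤ → Submodule k N) (j : ℤ) : Submodule k (M ⊗[R] N) :=
  Submodule.span k {x | ∃ (a b : ℤ) (m : M) (n : N),
    m ∈ ℳ a ∧ n ∈ 𝒩 b ∧ a + b = j ∧ x = m ⊗ₜ[R] n}

/-- A graded free resolution `⋯ ⟶ X₂ ⟶ X₁ ⟶ X₀ ⟶ M ⟶ 0` of a graded module: an exact complex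
of graded `R`-modules and degree-preserving `R`-linear maps, in which every `Xᵢ` is free with
a basis of homogeneous elements. -/
structure GradedFreeResolution (𝒜 : ℕ → Submodule k R) (ℳ : ℤ → Submodule k M) where
  X : ℕ → Type w
  [addCommGroup : ∀ i, AddCommGroup (X i)]
  [moduleBase : ∀ i, Module k (X i)]
  [module : ∀ i, Module R (X i)]
  [isScalarTower : ∀ i, IsScalarTower k R (X i)]
  grading : ∀ i, ℤ → Submodule k (X i)
  isGradedModule : ∀ i, IsGradedModule 𝒜 (grading i)
  exists_homogeneous_basis : ∀ i, ∃ (ι : Type w) (b : Module.Basis ι R (X i)),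
    ∀ s, ∃ j, b s ∈ grading i j
  d : ∀ i, X (i + 1) →ₗ[R] X i
  ε : X 0 →ₗ[R] M
  d_mem : ∀ i j x, x ∈ grading (i + 1) j → d i x ∈ grading i j
  ε_mem : ∀ j x, x ∈ grading 0 j → ε x ∈ ℳ j
  ε_surjective : Function.Surjective ε
  exact_zero : Function.Exact (d 0) ε
  exact_succ : ∀ i, Function.Exact (d (i + 1)) (d i)

namespace GradedFreeResolution

attribute [instance] addCommGroup moduleBase module isScalarTower

variable {𝒜 : ℕ → Submodule k R} {ℳ : ℤ → Submodule k M}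

/-- The `i`-cycles of the complex `X ⊗[R] N`. -/
def cycles (F : GradedFreeResolution.{w} 𝒜 ℳ) (N : Type*) [AddCommGroup N] [Module R N] :
    ∀ i : ℕ, Submodule R (F.X i ⊗[R] N)
  | 0 => ⊤
  | i + 1 => LinearMap.ker ((F.d i).rTensor N)

/-- The `i`-boundaries of the complex `X ⊗[R] N`, as a submodule of the `i`-cycles. -/
def boundaries (F : GradedFreeResolution.{w} 𝒜 ℳ) (N : Type*) [AddCommGroup N] [Module R N]
    (i : ℕ) : Submodule R (F.cycles N i) :=
  (LinearMap.range ((F.d i).rTensor N)).submoduleOf (F.cycles N i)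

/-- `Torᵢ(M, N)`, the `i`-th homology module of the complex `X ⊗[R] N`, where `X` is a graded
free resolution of `M`. -/
abbrev Tor (F : GradedFreeResolution.{w} 𝒜 ℳ) (N : Type*) [AddCommGroup N] [Module R N]
    (i : ℕ) : Type _ :=
  F.cycles N i ⧸ F.boundaries N i

/-- The degree `j` part of `Torᵢ(M, N)`: the classes of the homogeneous `i`-cycles of
degree `j` in `X ⊗[R] N`. -/
def torGrading (F : GradedFreeResolution.{w} 𝒜 ℳ) (𝒩 : ℤ → Submodule k N) (i : ℕ) (j : ℤ) :
    Submodule k (F.Tor N i) :=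
  ((tensorGrading R (F.grading i) 𝒩 j).comap
    ((F.cycles N i).subtype.restrictScalars k)).map
      ((F.boundaries N i).mkQ.restrictScalars k)

end GradedFreeResolution

/-- The coefficient of `t ^ j` in the Hilbert series of a graded vector space. -/
def hilbertCoeff {V : Type*} [AddCommGroup V] [Module k V] (𝒱 : ℤ → Submodule k V) (j : ℤ) : ℤ :=
  Module.finrank k (𝒱 j)

/-- The coefficient of `t ^ j` in `χ(M, N)(t) = ∑ᵢ (-1)ⁱ HS_{Torᵢ(M, N)}(t)`. -/
def chiCoeff {𝒜 : ℕ → Submodule k R} {ℳ : ℤ → Submodule k M}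
    (F : GradedFreeResolution.{w} 𝒜 ℳ) (𝒩 : ℤ → Submodule k N) (j : ℤ) : ℤ :=
  ∑ᶠ i : ℕ, (-1) ^ i * hilbertCoeff (F.torGrading 𝒩 i) j

end GradedModules


section Existence

/- Every graded module has a graded free resolution. -/

universe u v

variable {k : Type*} {R : Type u} {M : Type v} [Field k] [CommRing R] [Algebra k R]
  [AddCommGroup M] [Module k M] [Module R M]

/-- The grading of the free `R`-module on `ι` in which `b : ι` has degree `deg b`. -/
def freeGrading (𝒜 : ℕ → Submodule k R) {ι : Type*} (deg : ι → ℤ) (j : ℤ) :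
    Submodule k (ι →₀ R) :=
  Submodule.span k {x | ∃ (b : ι) (i : ℕ) (r : R),
    r ∈ 𝒜 i ∧ (i : ℤ) + deg b = j ∧ x = Finsupp.single b r}

theorem freeGrading_coord (𝒜 : ℕ → Submodule k R) [GradedAlgebra 𝒜] {ι : Type*}
    (deg : ι → ℤ) {j : ℤ} {f : ι →₀ R} (hf : f ∈ freeGrading 𝒜 deg j) (b : ι) (i : ℕ) :
    (DirectSum.decompose 𝒜 (f b) i : R) = if (i : ℤ) + deg b = j then f b else 0 := by
  classical
  induction hf using Submodule.span_induction with
  | mem x hx =>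
    obtain ⟨c, l, r, hr, rfl, rfl⟩ := hx
    by_cases hc : c = b
    · subst hc
      simp only [Finsupp.single_eq_same]
      by_cases hl : i = l
      · subst hl
        simp [DirectSum.decompose_of_mem_same 𝒜 hr]
      · rw [DirectSum.decompose_of_mem_ne 𝒜 hr (Ne.symm hl), if_neg (by omega)]
    · simp [Finsupp.single_eq_of_ne (Ne.symm hc)]
  | zero => simp
  | add x y _ _ hx hy =>
    simp only [Finsupp.add_apply, DirectSum.decompose_add, DirectSum.add_apply,
      Submodule.coe_add, hx, hy]
    split_ifs <;> simp
  | smul a x _ hx =>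
    simp only [Finsupp.smul_apply, DirectSum.decompose_smul, DirectSum.smul_apply,
      Submodule.coe_smul, hx]
    split_ifs <;> simp

theorem isGradedModule_freeGrading (𝒜 : ℕ → Submodule k R) [GradedAlgebra 𝒜] {ι : Type*}
    (deg : ι → ℤ) : IsGradedModule 𝒜 (freeGrading 𝒜 deg) where
  isInternal := by
    classical
    apply DirectSum.isInternal_submodule_of_iSupIndep_of_iSup_eq_top
    · rw [iSupIndep_iff_finsetSum_eq_zero_imp_eq_zero]
      intro s v hv hsum j hj
      ext b
      rw [Finsupp.zero_apply, ← DirectSum.sum_support_decompose 𝒜 (v j b)]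
      refine Finset.sum_eq_zero fun i _ => ?_
      have h0 : (DirectSum.decompose 𝒜 ((∑ l ∈ s, v l) b) i : R) = 0 := by
        rw [hsum]; simp
      have h1 : (DirectSum.decompose 𝒜 ((∑ l ∈ s, v l) b) i : R)
          = ∑ l ∈ s, if (i : ℤ) + deg b = l then v l b else 0 := by
        rw [Finsupp.finsetSum_apply, DirectSum.decompose_sum, DFinsupp.finsetSum_apply,
          AddSubmonoidClass.coe_finsetSum]
        exact Finset.sum_congr rfl fun l hl => freeGrading_coord 𝒜 deg (hv l hl) b i
      rw [freeGrading_coord 𝒜 deg (hv j hj) b i]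
      split_ifs with hij
      · rw [h0, Finset.sum_ite_eq, hij, if_pos hj] at h1
        exact h1.symm
      · rfl
    · rw [eq_top_iff]
      rintro f -
      induction f using Finsupp.induction_linear with
      | zero => exact zero_mem _
      | add f g hf hg => exact add_mem hf hg
      | single b r =>
        rw [← DirectSum.sum_support_decompose 𝒜 r, Finsupp.single_finsetSum]
        refine sum_mem fun i _ => Submodule.mem_iSup_of_mem ((i : ℤ) + deg b) ?_
        exact Submodule.subset_span ⟨b, i, _, SetLike.coe_mem _, rfl, rfl⟩
  smul_mem := by
    intro i j a m ha hm
    induction hm using Submodule.span_induction with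
    | mem x hx =>
      obtain ⟨c, l, r, hr, rfl, rfl⟩ := hx
      refine Submodule.subset_span ⟨c, i + l, a * r, SetLike.mul_mem_graded ha hr, ?_, ?_⟩
      · push_cast; ring
      · simp
    | zero => simp
    | add x y _ _ hx hy => rw [smul_add]; exact add_mem hx hy
    | smul c x _ hx => rw [smul_comm]; exact Submodule.smul_mem _ _ hx

theorem IsGradedModule.sum_mem_ker {X Y : Type*} [AddCommGroup X] [Module k X] [Module R X]
    [AddCommGroup Y] [Module k Y] [Module R Y] {𝒜 : ℕ → Submodule k R}
    {𝒳 : ℤ → Submodule k X} {𝒴 : ℤ → Submodule k Y} (h𝒳 : IsGradedModule 𝒜 𝒳)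
    (h𝒴 : IsGradedModule 𝒜 𝒴) (φ : X →ₗ[R] Y) (hφ : ∀ j x, x ∈ 𝒳 j → φ x ∈ 𝒴 j)
    {x : X} (hx : x ∈ LinearMap.ker φ) :
    x ∈ Submodule.span R {y | y ∈ LinearMap.ker φ ∧ ∃ j, y ∈ 𝒳 j} := by
  classical
  have htop : x ∈ ⨆ j, 𝒳 j := by rw [h𝒳.isInternal.submodule_iSup_eq_top]; trivial
  obtain ⟨f, hf, rfl⟩ := (Submodule.mem_iSup_iff_exists_finsupp _ _).1 htop
  have hind := (iSupIndep_iff_finsetSum_eq_zero_imp_eq_zero _).1 h𝒴.isInternal.submodule_iSupIndep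
  have hz := hind f.support (fun j => φ (f j)) (fun j _ => hφ j _ (hf j)) (by
    rw [← map_sum]; exact hx)
  exact sum_mem fun j hj => Submodule.subset_span ⟨hz j hj, j, hf j⟩

/-- The homogeneous elements of `K`, together with their degrees. -/
abbrev HomogeneousGen (ℳ : ℤ → Submodule k M) (K : Submodule R M) : Type v :=
  {p : ℤ × M // p.2 ∈ K ∧ p.2 ∈ ℳ p.1}

/-- The degree-preserving map to `M` from the free module on the homogeneous elements of `K`. -/
def genMap (ℳ : ℤ → Submodule k M) (K : Submodule R M) :
    (ULift.{u} (HomogeneousGen ℳ K) →₀ R) →ₗ[R] M :=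
  Finsupp.linearCombination R fun p => p.down.1.2

theorem genMap_mem {𝒜 : ℕ → Submodule k R} {ℳ : ℤ → Submodule k M} [IsScalarTower k R M]
    (hℳ : IsGradedModule 𝒜 ℳ) (K : Submodule R M) (j : ℤ)
    (x : ULift.{u} (HomogeneousGen ℳ K) →₀ R)
    (hx : x ∈ freeGrading 𝒜 (fun p => p.down.1.1) j) : genMap ℳ K x ∈ ℳ j := by
  induction hx using Submodule.span_induction with
  | mem x hx =>
    obtain ⟨c, l, r, hr, rfl, rfl⟩ := hx
    simpa [genMap] using hℳ.smul_mem hr c.down.2.2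
  | zero => simp
  | add x y _ _ hx hy => rw [map_add]; exact add_mem hx hy
  | smul c x _ hx =>
    rw [← algebraMap_smul R c x, map_smul, algebraMap_smul]; exact Submodule.smul_mem _ _ hx

theorem range_genMap {k : Type*} {R : Type u} {M : Type v} [Field k] [CommRing R]
    [AddCommGroup M] [Module k M] [Module R M] (ℳ : ℤ → Submodule k M) (K : Submodule R M)
    (hK : K ≤ Submodule.span R {y | y ∈ K ∧ ∃ j, y ∈ ℳ j}) :
    LinearMap.range (genMap ℳ K : (ULift.{u} (HomogeneousGen ℳ K) →₀ R) →ₗ[R] M) = K := by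
  rw [genMap, Finsupp.range_linearCombination]
  apply le_antisymm
  · rw [Submodule.span_le]
    rintro _ ⟨p, rfl⟩
    exact p.down.2.1
  · refine hK.trans (Submodule.span_mono ?_)
    rintro y ⟨hy, j, hj⟩
    exact ⟨⟨⟨(j, y), hy, hj⟩⟩, rfl⟩

/-- A free module with graded basis `ι`, and a submodule generated by homogeneous elements. -/
structure ResolutionStage (𝒜 : ℕ → Submodule k R) where
  ι : Type (max u v)
  deg : ι → ℤ
  K : Submodule R (ι →₀ R)
  le_span : K ≤ Submodule.span R {y | y ∈ K ∧ ∃ j, y ∈ freeGrading 𝒜 deg j}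

/-- The next free module, mapping onto `K`, with the kernel of this map. -/
def ResolutionStage.next {𝒜 : ℕ → Submodule k R} [GradedAlgebra 𝒜]
    (S : ResolutionStage.{u, v} 𝒜) : ResolutionStage.{u, v} 𝒜 where
  ι := ULift.{u} (HomogeneousGen (freeGrading 𝒜 S.deg) S.K)
  deg p := p.down.1.1
  K := LinearMap.ker (genMap (freeGrading 𝒜 S.deg) S.K)
  le_span _ hx := (isGradedModule_freeGrading 𝒜 _).sum_mem_ker
    (isGradedModule_freeGrading 𝒜 S.deg) _
    (genMap_mem (isGradedModule_freeGrading 𝒜 S.deg) S.K) hx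

theorem GradedFreeResolution.nonempty (𝒜 : ℕ → Submodule k R) [GradedAlgebra 𝒜]
    [IsScalarTower k R M] (ℳ : ℤ → Submodule k M) (hℳ : IsGradedModule 𝒜 ℳ) :
    Nonempty (GradedFreeResolution.{max u v} 𝒜 ℳ) := by
  classical
  let S₀ : ResolutionStage.{u, v} 𝒜 :=
    { ι := ULift.{u} (HomogeneousGen ℳ (⊤ : Submodule R M))
      deg := fun p => p.down.1.1
      K := LinearMap.ker (genMap ℳ ⊤)
      le_span := fun _ hx => (isGradedModule_freeGrading 𝒜 _).sum_mem_ker hℳ _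
        (genMap_mem hℳ ⊤) hx }
  let S : ℕ → ResolutionStage.{u, v} 𝒜 := fun n => Nat.rec S₀ (fun _ T => T.next) n
  have hrange : ∀ n, LinearMap.range (genMap (freeGrading 𝒜 (S n).deg) (S n).K :
      ((S (n + 1)).ι →₀ R) →ₗ[R] _) = (S n).K :=
    fun n => range_genMap _ _ (S n).le_span
  exact ⟨{
    X := fun n => (S n).ι →₀ R
    grading := fun n => freeGrading 𝒜 (S n).deg
    isGradedModule := fun n => isGradedModule_freeGrading 𝒜 _
    exists_homogeneous_basis := fun n => ⟨(S n).ι, Finsupp.basisSingleOne, fun s =>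
      ⟨(S n).deg s, Submodule.subset_span ⟨s, 0, 1, SetLike.GradedOne.one_mem, by simp, by simp⟩⟩⟩
    d := fun n => genMap (freeGrading 𝒜 (S n).deg) (S n).K
    ε := genMap ℳ ⊤
    d_mem := fun n => genMap_mem (isGradedModule_freeGrading 𝒜 (S n).deg) (S n).K
    ε_mem := genMap_mem hℳ ⊤
    ε_surjective := by
      rw [← LinearMap.range_eq_top]
      refine range_genMap ℳ ⊤ fun x _ => ?_
      have htop : x ∈ ⨆ j, ℳ j := by rw [hℳ.isInternal.submodule_iSup_eq_top]; trivial
      obtain ⟨f, hf, rfl⟩ := (Submodule.mem_iSup_iff_exists_finsupp _ _).1 htop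
      exact sum_mem fun j _ => Submodule.subset_span ⟨trivial, j, hf j⟩
    exact_zero := fun y => (SetLike.ext_iff.1 (hrange 0) y).symm
    exact_succ := fun n y => (SetLike.ext_iff.1 (hrange (n + 1)) y).symm }⟩

end Existence

end

/-!
The theorem rests on two statements about formal Laurent series.

*Hilbert series of modules.* If `M ≠ 0` is a finitely generated graded `R`-module of dimension `m`,
then `HS_M(t) = e_M(t) / (1 - t) ^ m`, where `e_M` is a rational function with a positive value
at `1` (`IsGradedModule.exists_hilbertSeries_eq`). By Hilbert–Serre, `HS_M` is a rational function
(`IsGradedModule.hilbertSeries_mem_range`). Its pole at `1` is found without homogeneous systems of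
parameters: by Noether normalization, `R / Ann M` is finite over a polynomial ring in `m` variables,
which acts faithfully on `M`, and the sums of the dimensions of the first `n + 1` homogeneous
components of `M` therefore lie between two positive multiples of `n ^ m`, up to a linear
reparametrization of `n` in the lower bound (`IsGradedModule.exists_growth`). The generating
function of these sums, multiplied by `(1 - t) ^ (m + 1)`, is hence bounded and bounded away from
zero as `t` increases to `1`, which pins down the order of the pole and the sign of its leading
coefficient (`exists_pos_eval_one_of_growth`). No homogeneity of the normalization is needed for
this.

*The Euler characteristic.* `χ(M, N) · HS_R = HS_M · HS_N`
(`GradedFreeResolution.eulerSeries_mul`). Let `N` vanish below degree `b`, and choose a graded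
presentation `0 → K → G → N → 0`, with `G` free and graded of finite rank, which is an isomorphism
in degree `b`; then `K` vanishes below degree `b + 1`
(`IsGradedModule.exists_graded_presentation`). The long exact sequence of Tor reduces
`Torᵢ₊₁(M, N)` to `Torᵢ(M, K)`, so that `Torᵢ(M, N)` vanishes in degrees below `b₀ + b + i`, where
`M` vanishes below degree `b₀` (`GradedFreeResolution.torVanishing`). This gives all the finiteness
statements. Both sides of the formula are additive along the presentation, and they agree for `G`.
The defect for `N` is thus minus the defect for `K`, which starts in a higher degree; after
iteration the defect vanishes in every degree. Only the resolution of `M` enters, in the form of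
the exactness of `X ⊗ G` in positive degrees and of the short exact sequences
`0 → Xᵢ ⊗ K → Xᵢ ⊗ G → Xᵢ ⊗ N → 0`.

Together, `χ(M, N) = (e_M e_N / e_R) / (1 - t) ^ (dim M + dim N - dim R)`.
-/

noncomputable section

/-! ### Homogeneous components -/

section Components

variable {k V W : Type*} [Field k] [AddCommGroup V] [Module k V] [AddCommGroup W] [Module k W]
  {𝒱 : ℤ → Submodule k V} {𝒲 : ℤ → Submodule k W}

theorem DirectSum.IsInternal.bijective_coeLinearMap (h : DirectSum.IsInternal 𝒱) :
    Function.Bijective (DirectSum.coeLinearMap 𝒱) := h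

/-- The projection of a `ℤ`-graded vector space onto its component of degree `j`. -/
def DirectSum.IsInternal.component (h : DirectSum.IsInternal 𝒱) (j : ℤ) : V →ₗ[k] V :=
  (𝒱 j).subtype ∘ₗ DirectSum.component k ℤ (fun i => 𝒱 i) j ∘ₗ
    (LinearEquiv.ofBijective (DirectSum.coeLinearMap 𝒱) h.bijective_coeLinearMap).symm.toLinearMap

namespace DirectSum.IsInternal

variable (h : DirectSum.IsInternal 𝒱) (h' : DirectSum.IsInternal 𝒲)

theorem component_mem (j : ℤ) (x : V) : h.component j x ∈ 𝒱 j := by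
  simp [component]

theorem symm_of_mem {j : ℤ} {x : V} (hx : x ∈ 𝒱 j) :
    (LinearEquiv.ofBijective (DirectSum.coeLinearMap 𝒱) h.bijective_coeLinearMap).symm x =
      DirectSum.lof k ℤ (fun i => 𝒱 i) j ⟨x, hx⟩ := by
  rw [LinearEquiv.symm_apply_eq, LinearEquiv.ofBijective_apply, DirectSum.coeLinearMap_lof]

theorem component_of_mem {j : ℤ} {x : V} (hx : x ∈ 𝒱 j) : h.component j x = x := by
  simp [component, h.symm_of_mem hx, DirectSum.component.lof_self]

theorem component_of_mem_ne {i j : ℤ} (hij : i ≠ j) {x : V} (hx : x ∈ 𝒱 i) :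
    h.component j x = 0 := by
  simp [component, h.symm_of_mem hx, DirectSum.component.of, hij]

@[elab_as_elim]
theorem induction_on (h : DirectSum.IsInternal 𝒱) {P : V → Prop} (x : V)
    (hom : ∀ j, ∀ y ∈ 𝒱 j, P y) (zero : P 0) (add : ∀ y z, P y → P z → P (y + z)) : P x := by
  have hx : x ∈ ⨆ j, 𝒱 j := by rw [h.submodule_iSup_eq_top]; trivial
  exact Submodule.iSup_induction 𝒱 (motive := P) hx hom zero add

theorem exists_sum_component (x : V) : ∃ s : Finset ℤ, ∑ j ∈ s, h.component j x = x ∧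
    ∀ j ∉ s, h.component j x = 0 := by
  classical
  refine h.induction_on x (fun j y hy => ⟨{j}, by simp [h.component_of_mem hy], ?_⟩) ⟨∅, by simp⟩ ?_
  · intro i hi
    exact h.component_of_mem_ne (by simpa [eq_comm] using hi) hy
  · rintro y z ⟨s, hs, hs'⟩ ⟨t, ht, ht'⟩
    refine ⟨s ∪ t, ?_, fun j hj => ?_⟩
    · simp only [map_add, Finset.sum_add_distrib]
      congr 1
      · rw [← Finset.sum_subset Finset.subset_union_left fun j _ hj => hs' j hj, hs]
      · rw [← Finset.sum_subset Finset.subset_union_right fun j _ hj => ht' j hj, ht]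
    · rw [Finset.mem_union, not_or] at hj
      rw [map_add, hs' j hj.1, ht' j hj.2, add_zero]

theorem ext_component {x y : V} (hxy : ∀ j, h.component j x = h.component j y) : x = y := by
  rw [← sub_eq_zero]
  obtain ⟨s, hs, -⟩ := h.exists_sum_component (x - y)
  rw [← hs]
  exact Finset.sum_eq_zero fun j _ => by rw [map_sub, hxy, sub_self]

/-- A linear map of degree `a` commutes with taking components. -/
theorem map_component (φ : V →ₗ[k] W) (a : ℤ) (hφ : ∀ j, ∀ x ∈ 𝒱 j, φ x ∈ 𝒲 (j + a)) (j : ℤ)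
    (x : V) : h'.component (j + a) (φ x) = φ (h.component j x) := by
  refine h.induction_on x (fun i y hy => ?_) (by simp) fun y z hy hz => by
    simp only [map_add, hy, hz]
  by_cases hij : i = j
  · subst hij
    rw [h.component_of_mem hy, h'.component_of_mem (hφ _ _ hy)]
  · rw [h.component_of_mem_ne hij hy, h'.component_of_mem_ne _ (hφ _ _ hy), map_zero]
    omega

/-- A homogeneous element of the range of a graded map is the image of a homogeneous element. -/
theorem exists_mem_of_mem_range (h : DirectSum.IsInternal 𝒱) (h' : DirectSum.IsInternal 𝒲)
    (φ : V →ₗ[k] W) (hφ : ∀ j, ∀ x ∈ 𝒱 j, φ x ∈ 𝒲 j)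
    {j : ℤ} {y : W} (hy : y ∈ 𝒲 j) (hy' : ∃ x, φ x = y) : ∃ x ∈ 𝒱 j, φ x = y := by
  obtain ⟨x, rfl⟩ := hy'
  refine ⟨h.component j x, h.component_mem j x, ?_⟩
  have := h.map_component h' φ 0 (by simpa using hφ) j x
  rw [← this, add_zero, h'.component_of_mem hy]

end DirectSum.IsInternal

theorem isInternal_of_components (p : ℤ → V →ₗ[k] V)
    (hp : ∀ j, ∀ x ∈ 𝒱 j, p j x = x) (hp' : ∀ i j, i ≠ j → ∀ x ∈ 𝒱 i, p j x = 0)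
    (hsum : ∀ x, x ∈ ⨆ j, 𝒱 j) : DirectSum.IsInternal 𝒱 := by
  apply DirectSum.isInternal_submodule_of_iSupIndep_of_iSup_eq_top
  · rw [iSupIndep_iff_finsetSum_eq_zero_imp_eq_zero]
    intro s v hv hs j hj
    have := congrArg (p j) hs
    rw [map_sum, map_zero, Finset.sum_eq_single j, hp _ _ (hv j hj)] at this
    · exact this
    · exact fun i hi hij => hp' i j hij _ (hv i hi)
    · exact fun h => absurd hj h
  · exact eq_top_iff.2 fun x _ => hsum x

end Components

/-! ### Graded submodules, quotients and direct sums -/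

section Constructions

variable {k R M N : Type*} [Field k] [CommRing R] [Algebra k R]
  [AddCommGroup M] [Module k M] [Module R M] [IsScalarTower k R M]
  [AddCommGroup N] [Module k N] [Module R N] [IsScalarTower k R N]
  {𝒜 : ℕ → Submodule k R} {ℳ : ℤ → Submodule k M} {𝒩 : ℤ → Submodule k N}

/-- Multiplication by a scalar of `R`, as a `k`-linear map. -/
def smulMap (k M : Type*) {R : Type*} [Field k] [CommRing R] [Algebra k R]
    [AddCommGroup M] [Module k M] [Module R M] [IsScalarTower k R M] (a : R) : M →ₗ[k] M :=
  (LinearMap.lsmul R M a).restrictScalars k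

theorem IsGradedModule.component_smul (h : IsGradedModule 𝒜 ℳ) {i : ℕ} {a : R} (ha : a ∈ 𝒜 i)
    (j : ℤ) (m : M) :
    h.isInternal.component (j + i) (a • m) = a • h.isInternal.component j m :=
  h.isInternal.map_component h.isInternal (smulMap k M a) i
    (fun j x hx => by rw [add_comm]; exact h.smul_mem ha hx) j m

theorem IsGradedModule.smul_eq_zero_of_smul_eq_zero (h : IsGradedModule 𝒜 ℳ) {i : ℕ} {a : R}
    (ha : a ∈ 𝒜 i) {m : M} (hm : a • m = 0) (j : ℤ) : a • h.isInternal.component j m = 0 := by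
  rw [← h.component_smul ha, hm, map_zero]

/-- The induced grading of a submodule. It is a grading if the submodule contains the components
of its elements. -/
def subGrading (ℳ : ℤ → Submodule k M) (K : Submodule R M) (j : ℤ) : Submodule k K :=
  (ℳ j).comap (K.subtype.restrictScalars k)

/-- The induced grading of the quotient by a submodule. It is a grading if the submodule contains
the components of its elements. -/
def quotGrading (ℳ : ℤ → Submodule k M) (K : Submodule R M) (j : ℤ) : Submodule k (M ⧸ K) :=
  (ℳ j).map (K.mkQ.restrictScalars k)

theorem isGradedModule_subGrading (h : IsGradedModule 𝒜 ℳ) (K : Submodule R M)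
    (hK : ∀ x ∈ K, ∀ j, h.isInternal.component j x ∈ K) :
    IsGradedModule 𝒜 (subGrading ℳ K) where
  isInternal := by
    refine isInternal_of_components
      (fun j => (h.isInternal.component j).restrict
        (p := K.restrictScalars k) (q := K.restrictScalars k) fun x hx => hK x hx j)
      (fun j x hx => Subtype.ext (h.isInternal.component_of_mem hx))
      (fun i j hij x hx => Subtype.ext (h.isInternal.component_of_mem_ne hij hx)) fun x => ?_
    obtain ⟨s, hs, -⟩ := h.isInternal.exists_sum_component (x : M)
    have : x = ∑ j ∈ s, (⟨h.isInternal.component j x, hK x x.2 j⟩ : K) :=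
      Subtype.ext (by rw [AddSubmonoidClass.coe_finsetSum]; exact hs.symm)
    rw [this]
    exact sum_mem fun j _ => Submodule.mem_iSup_of_mem j (h.isInternal.component_mem j _)
  smul_mem ha hm := h.smul_mem ha hm

theorem isGradedModule_quotGrading (h : IsGradedModule 𝒜 ℳ) (K : Submodule R M)
    (hK : ∀ x ∈ K, ∀ j, h.isInternal.component j x ∈ K) :
    IsGradedModule 𝒜 (quotGrading ℳ K) where
  isInternal := by
    refine isInternal_of_components
      (fun j => Submodule.mapQ (K.restrictScalars k) (K.restrictScalars k)
        (h.isInternal.component j) fun x hx => hK x hx j) ?_ ?_ fun x => ?_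
    · rintro j _ ⟨x, hx, rfl⟩
      exact congrArg (K.mkQ) (h.isInternal.component_of_mem hx)
    · rintro i j hij _ ⟨x, hx, rfl⟩
      exact (congrArg (K.mkQ) (h.isInternal.component_of_mem_ne hij hx)).trans (map_zero _)
    · obtain ⟨x, rfl⟩ := K.mkQ_surjective x
      obtain ⟨s, hs, -⟩ := h.isInternal.exists_sum_component x
      rw [← hs, map_sum]
      exact sum_mem fun j _ => Submodule.mem_iSup_of_mem j
        ⟨_, h.isInternal.component_mem j _, rfl⟩
  smul_mem := by
    rintro i j a _ ha ⟨x, hx, rfl⟩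
    exact ⟨a • x, h.smul_mem ha hx, by simp⟩

theorem component_mem_ker (h : IsGradedModule 𝒜 ℳ) (h' : IsGradedModule 𝒜 𝒩) (φ : M →ₗ[R] N)
    (hφ : ∀ j, ∀ x ∈ ℳ j, φ x ∈ 𝒩 j) (x : M) (hx : x ∈ LinearMap.ker φ) (j : ℤ) :
    h.isInternal.component j x ∈ LinearMap.ker φ := by
  have := h.isInternal.map_component h'.isInternal (φ.restrictScalars k) 0 (by simpa using hφ) j x
  rw [LinearMap.mem_ker] at hx ⊢
  simp only [LinearMap.coe_restrictScalars, hx, map_zero] at this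
  exact this.symm

/-- The grading of the direct sum of copies of a graded module, shifted by `deg`. It is defined
coordinatewise, which is more convenient for dimension counts than the spanning set in the
definition of `freeGrading`. -/
def finsuppGrading {ι : Type*} (𝒩 : ℤ → Submodule k N) (deg : ι → ℤ) (j : ℤ) :
    Submodule k (ι →₀ N) where
  carrier := {f | ∀ s, f s ∈ 𝒩 (j - deg s)}
  add_mem' hf hg s := add_mem (hf s) (hg s)
  zero_mem' _ := zero_mem _
  smul_mem' c _ hf s := Submodule.smul_mem _ c (hf s)

omit [IsScalarTower k R N] in
theorem isGradedModule_finsuppGrading {ι : Type*} (h : IsGradedModule 𝒜 𝒩) (deg : ι → ℤ) :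
    IsGradedModule 𝒜 (finsuppGrading 𝒩 deg) where
  isInternal := by
    classical
    let p : ℤ → (ι →₀ N) →ₗ[k] (ι →₀ N) := fun j => Finsupp.lsum k fun s =>
      Finsupp.lsingle s ∘ₗ h.isInternal.component (j - deg s)
    have hp : ∀ j f s, p j f s = h.isInternal.component (j - deg s) (f s) := by
      intro j f s
      induction f using Finsupp.induction_linear with
      | zero => simp
      | add f g hf hg => simp only [map_add, Finsupp.add_apply, hf, hg]
      | single t x =>
        simp only [p, Finsupp.lsum_single, LinearMap.comp_apply, Finsupp.lsingle_apply]
        by_cases hst : t = s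
        · subst hst; simp
        · simp [Finsupp.single_eq_of_ne (Ne.symm hst)]
    refine isInternal_of_components p (fun j x hx => ?_) (fun i j hij x hx => ?_) fun f => ?_
    · ext s; rw [hp, h.isInternal.component_of_mem (hx s)]
    · ext s; rw [hp, h.isInternal.component_of_mem_ne _ (hx s), Finsupp.zero_apply]; omega
    · induction f using Finsupp.induction_linear with
      | zero => exact zero_mem _
      | add f g hf hg => exact add_mem hf hg
      | single t x =>
        refine h.isInternal.induction_on x (fun j y hy => ?_) (by simp) fun y z hy hz => by
          rw [Finsupp.single_add]; exact add_mem hy hz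
        refine Submodule.mem_iSup_of_mem (j + deg t) fun s => ?_
        by_cases hst : t = s
        · subst hst; simpa using hy
        · simp [Finsupp.single_eq_of_ne (Ne.symm hst)]
  smul_mem ha hm s := by
    rw [add_sub_assoc]
    exact h.smul_mem ha (hm s)

/-- The `ℕ`-grading of `R`, extended by zero to negative degrees, so that `R` is a graded module
over itself. -/
def intGrading (𝒜 : ℕ → Submodule k R) (j : ℤ) : Submodule k R :=
  if 0 ≤ j then 𝒜 j.toNat else ⊥

theorem intGrading_natCast (𝒜 : ℕ → Submodule k R) (i : ℕ) : intGrading 𝒜 i = 𝒜 i := by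
  simp [intGrading]

theorem intGrading_of_neg (𝒜 : ℕ → Submodule k R) {j : ℤ} (hj : j < 0) :
    intGrading 𝒜 j = ⊥ := by
  simp [intGrading, hj]

theorem isGradedModule_intGrading (𝒜 : ℕ → Submodule k R) [GradedAlgebra 𝒜] :
    IsGradedModule 𝒜 (intGrading 𝒜) where
  isInternal := by
    classical
    -- The projections below use `Int.toNat`, which is junk in negative degrees.
    have h0 : ∀ (j : ℤ) (x : R), x ∈ intGrading 𝒜 j → 0 ≤ j ∨ x = 0 := by
      intro j x hx
      by_contra! hj
      rw [intGrading_of_neg 𝒜 hj.1] at hx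
      exact hj.2 (by simpa using hx)
    refine isInternal_of_components
      (fun j => if 0 ≤ j then GradedAlgebra.proj 𝒜 j.toNat else 0) ?_ ?_ fun x => ?_
    · intro j x hx
      rcases h0 j x hx with hj | rfl
      · rw [intGrading, if_pos hj] at hx
        rw [if_pos hj, GradedAlgebra.proj_apply, DirectSum.decompose_of_mem_same 𝒜 hx]
      · simp
    · intro i j hij x hx
      rcases h0 i x hx with hi | rfl
      · rw [intGrading, if_pos hi] at hx
        split_ifs with hj
        · rw [GradedAlgebra.proj_apply, DirectSum.decompose_of_mem_ne 𝒜 hx (by omega)]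
        · rfl
      · simp
    · rw [← DirectSum.sum_support_decompose 𝒜 x]
      refine sum_mem fun i _ => Submodule.mem_iSup_of_mem (i : ℤ) ?_
      rw [intGrading_natCast]
      exact SetLike.coe_mem _
  smul_mem := by
    intro i j a m ha hm
    rcases lt_or_ge j 0 with hj | hj
    · rw [intGrading_of_neg 𝒜 hj] at hm
      rw [(Submodule.mem_bot k).1 hm, smul_zero]; exact zero_mem _
    · lift j to ℕ using hj
      rw [intGrading_natCast] at hm
      rw [← Nat.cast_add, intGrading_natCast]
      exact SetLike.mul_mem_graded ha hm

end Constructions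

/-! ### Homogeneous generators -/

section Generators

variable {k R M : Type*} [Field k] [CommRing R] [Algebra k R]
  [AddCommGroup M] [Module k M] [Module R M] [IsScalarTower k R M]
  {𝒜 : ℕ → Submodule k R} {ℳ : ℤ → Submodule k M}

theorem exists_algebraMap_eq_of_mem_zero (h𝒜 : 𝒜 0 = 1) {r : R} (hr : r ∈ 𝒜 0) :
    ∃ c : k, algebraMap k R c = r := by
  rw [h𝒜] at hr
  exact Submodule.mem_one.1 hr

theorem exists_homogeneous_algebra_generators (𝒜 : ℕ → Submodule k R) [GradedAlgebra 𝒜]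
    (h𝒜 : 𝒜 0 = 1) [Algebra.FiniteType k R] :
    ∃ S : Finset R, Algebra.adjoin k (S : Set R) = ⊤ ∧ ∀ x ∈ S, ∃ n : ℕ, n ≠ 0 ∧ x ∈ 𝒜 n := by
  -- Mathlib's theorem on homogeneous generators is about `R` as an algebra over `𝒜 0`.
  have : Algebra.FiniteType (𝒜 0) R := by
    obtain ⟨F, hF⟩ := Algebra.FiniteType.out (R := k) (A := R)
    refine ⟨F, eq_top_iff.2 fun r _ => ?_⟩
    have hr : r ∈ Algebra.adjoin k (F : Set R) := by rw [hF]; trivial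
    induction hr using Algebra.adjoin_induction with
    | mem x hx => exact Algebra.subset_adjoin hx
    | algebraMap c =>
      have hc : algebraMap k R c ∈ 𝒜 0 := h𝒜 ▸ Submodule.algebraMap_mem c
      exact Subalgebra.algebraMap_mem (Algebra.adjoin (𝒜 0) (F : Set R)) (⟨_, hc⟩ : 𝒜 0)
    | add x y _ _ hx hy => exact add_mem (hx trivial) (hy trivial)
    | mul x y _ _ hx hy => exact mul_mem (hx trivial) (hy trivial)
  obtain ⟨S, hS, hS'⟩ := GradedAlgebra.exists_finset_adjoin_eq_top_and_homogeneous_ne_zero 𝒜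
  refine ⟨S, eq_top_iff.2 fun r _ => ?_, hS'⟩
  have hr : r ∈ Algebra.adjoin (𝒜 0) (S : Set R) := by rw [hS]; trivial
  induction hr using Algebra.adjoin_induction with
  | mem x hx => exact Algebra.subset_adjoin hx
  | algebraMap c =>
    obtain ⟨a, ha⟩ := exists_algebraMap_eq_of_mem_zero h𝒜 c.2
    change (c : R) ∈ _
    rw [← ha]
    exact Subalgebra.algebraMap_mem _ a
  | add x y _ _ hx hy => exact add_mem (hx trivial) (hy trivial)
  | mul x y _ _ hx hy => exact mul_mem (hx trivial) (hy trivial)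

namespace IsGradedModule

omit [IsScalarTower k R M] in
theorem exists_homogeneous_generators (h : IsGradedModule 𝒜 ℳ) [Module.Finite R M] :
    ∃ G : Finset (ℤ × M), (∀ p ∈ G, p.2 ∈ ℳ p.1) ∧
      Submodule.span R (Prod.snd '' (G : Set (ℤ × M))) = ⊤ := by
  classical
  have htop : Submodule.span R {m : M | ∃ j, m ∈ ℳ j} = ⊤ := by
    refine eq_top_iff.2 fun m _ => ?_
    obtain ⟨s, hs, -⟩ := h.isInternal.exists_sum_component m
    rw [← hs]
    exact sum_mem fun j _ => Submodule.subset_span ⟨j, h.isInternal.component_mem j m⟩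
  obtain ⟨T, hT, hT'⟩ := (Submodule.fg_span_iff_fg_span_finset_subset _).1
    (htop ▸ (Module.Finite.fg_top : (⊤ : Submodule R M).FG))
  have hT : ∀ m ∈ T, ∃ j, m ∈ ℳ j := fun m hm => hT hm
  choose! d hd using hT
  refine ⟨T.image fun m => (d m, m), ?_, ?_⟩
  · intro p hp
    obtain ⟨m, hm, rfl⟩ := Finset.mem_image.1 hp
    exact hd m hm
  · rw [← htop, hT']
    congr 1
    ext m
    simp

/-- If a family `L` of subspaces contains homogeneous generators of a graded module in their
degrees, and is stable under homogeneous algebra generators of `R`, then it contains the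
homogeneous components of the module. -/
theorem le_of_generators (h : IsGradedModule 𝒜 ℳ) {S : Set R} (hS : Algebra.adjoin k S = ⊤)
    {G : Set (ℤ × M)} (hG : Submodule.span R (Prod.snd '' G) = ⊤) (L : ℤ → Submodule k M)
    (hGℳ : ∀ p ∈ G, p.2 ∈ ℳ p.1) (hGL : ∀ p ∈ G, p.2 ∈ L p.1)
    (hL : ∀ x ∈ S, ∃ d : ℕ, x ∈ 𝒜 d ∧ ∀ j, ∀ m ∈ L j, x • m ∈ L (j + d)) (j : ℤ) :
    ℳ j ≤ L j := by
  -- The elements whose components all lie in `L` form an `R`-submodule which contains `G`.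
  let Q : Submodule k M := ⨅ j, (L j).comap (h.isInternal.component j)
  have hQ : ∀ m, m ∈ Q ↔ ∀ j, h.isInternal.component j m ∈ L j := by simp [Q]
  have hsmul : ∀ r : R, ∀ m ∈ Q, r • m ∈ Q := by
    intro r
    have hr : r ∈ Algebra.adjoin k S := by rw [hS]; trivial
    induction hr using Algebra.adjoin_induction with
    | mem x hx =>
      intro m hm
      obtain ⟨d, hd, hxd⟩ := hL x hx
      rw [hQ] at hm ⊢
      intro j
      have := h.component_smul hd (j - d) m
      rw [sub_add_cancel] at this
      rw [this]
      simpa using hxd _ _ (hm (j - d))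
    | algebraMap c =>
      intro m hm
      rw [algebraMap_smul]
      exact Q.smul_mem c hm
    | add x y _ _ hx hy => intro m hm; rw [add_smul]; exact add_mem (hx m hm) (hy m hm)
    | mul x y _ _ hx hy => intro m hm; rw [mul_smul]; exact hx _ (hy m hm)
  have htop : ∀ m : M, m ∈ Q := by
    intro m
    have hm : m ∈ Submodule.span R (Prod.snd '' G) := by rw [hG]; trivial
    induction hm using Submodule.span_induction with
    | mem x hx =>
      obtain ⟨p, hp, rfl⟩ := hx
      rw [hQ]
      intro i
      by_cases hi : p.1 = i
      · subst hi
        rw [h.isInternal.component_of_mem (hGℳ p hp)]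
        exact hGL p hp
      · rw [h.isInternal.component_of_mem_ne hi (hGℳ p hp)]
        exact zero_mem _
    | zero => exact zero_mem _
    | add x y _ _ hx hy => exact add_mem hx hy
    | smul r x _ hx => exact hsmul r x hx
  intro m hm
  have := (hQ m).1 (htop m) j
  rwa [h.isInternal.component_of_mem hm] at this

theorem eq_bot_of_lt_generators (h : IsGradedModule 𝒜 ℳ) {S : Set R}
    (hS : Algebra.adjoin k S = ⊤) (hS' : ∀ x ∈ S, ∃ n : ℕ, n ≠ 0 ∧ x ∈ 𝒜 n)
    {G : Set (ℤ × M)} (hG : Submodule.span R (Prod.snd '' G) = ⊤)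
    (hGℳ : ∀ p ∈ G, p.2 ∈ ℳ p.1) {b : ℤ} (hb : ∀ p ∈ G, b ≤ p.1) {j : ℤ} (hj : j < b) :
    ℳ j = ⊥ := by
  have := h.le_of_generators hS hG (fun j => if j < b then ⊥ else ⊤) hGℳ
    (fun p hp => by simp [not_lt.2 (hb p hp)]) (fun x hx => ?_) j
  · simpa [hj] using this
  · obtain ⟨n, -, hn⟩ := hS' x hx
    refine ⟨n, hn, fun i m hm => ?_⟩
    by_cases hi : i < b
    · simp only [hi, if_true, Submodule.mem_bot] at hm
      simp [hm]
    · rw [if_neg (by omega)]; trivial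

theorem exists_eq_bot_of_lt [GradedAlgebra 𝒜] (h𝒜 : 𝒜 0 = 1) [Algebra.FiniteType k R]
    [Module.Finite R M] (h : IsGradedModule 𝒜 ℳ) : ∃ b : ℤ, ∀ j < b, ℳ j = ⊥ := by
  classical
  obtain ⟨S, hS, hS'⟩ := exists_homogeneous_algebra_generators 𝒜 h𝒜
  obtain ⟨G, hG, hG'⟩ := h.exists_homogeneous_generators
  obtain ⟨b, hb⟩ := (G.image Prod.fst).bddBelow
  exact ⟨b, fun j hj => h.eq_bot_of_lt_generators hS hS' hG' hG
    (fun p hp => hb (by simpa using ⟨p.2, hp⟩)) hj⟩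

end IsGradedModule

end Generators

/-! ### Krull dimension of integral extensions -/

section KrullDim

/-- An injective integral ring homomorphism preserves the Krull dimension: incomparability
gives one inequality, and going up gives the other one. -/
theorem ringKrullDim_eq_of_isIntegral (A B : Type*) [CommRing A] [CommRing B] [Algebra A B]
    [Algebra.IsIntegral A B] (hinj : Function.Injective (algebraMap A B)) :
    ringKrullDim B = ringKrullDim A := by
  apply le_antisymm
  · refine Order.krullDim_le_of_strictMono (PrimeSpectrum.comap (algebraMap A B)) ?_
    intro p q hpq
    obtain ⟨hle, x, hxq, hxp⟩ := SetLike.lt_iff_le_and_exists.1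
      (show p.asIdeal < q.asIdeal from hpq)
    exact Ideal.comap_lt_comap_of_integral_mem_sdiff hle ⟨hxq, hxp⟩
      (Algebra.IsIntegral.isIntegral x)
  · refine iSup_le fun l => ?_
    -- Lift a chain of primes of `A` from the bottom upwards.
    have key : ∀ (n : ℕ) (l : LTSeries (PrimeSpectrum A)), l.length = n →
        ∃ l' : LTSeries (PrimeSpectrum B), l'.length = n ∧
          PrimeSpectrum.comap (algebraMap A B) l'.last = l.last := by
      intro n
      induction n with
      | zero =>
        intro l _
        obtain ⟨Q, -, hQ, hQ'⟩ := Ideal.exists_ideal_over_prime_of_isIntegral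
          (S := B) l.last.asIdeal ⊥ (by
            intro x hx
            have : x = 0 := hinj (by simpa using hx)
            simp [this])
        exact ⟨RelSeries.singleton _ ⟨Q, hQ⟩, rfl, PrimeSpectrum.ext hQ'⟩
      | succ n ih =>
        intro l hl
        obtain ⟨l', hl', hlast⟩ := ih l.eraseLast (by simp [hl])
        have hlt : l.eraseLast.last < l.last := l.eraseLast_last_rel_last (by omega)
        obtain ⟨Q, hle, hQ, hQ'⟩ := Ideal.exists_ideal_over_prime_of_isIntegral
          (S := B) l.last.asIdeal l'.last.asIdeal (by
            have := congrArg PrimeSpectrum.asIdeal hlast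
            rw [PrimeSpectrum.comap_asIdeal] at this
            rw [this]
            exact hlt.le)
        have hlt' : l'.last < ⟨Q, hQ⟩ := by
          refine lt_of_le_of_ne hle fun heq => hlt.ne ?_
          rw [← hlast, heq]
          exact PrimeSpectrum.ext hQ'
        exact ⟨l'.snoc ⟨Q, hQ⟩ hlt', by simp [hl'], by simpa using PrimeSpectrum.ext hQ'⟩
    obtain ⟨l', hl', -⟩ := key l.length l rfl
    rw [← hl']
    exact le_iSup (fun l : LTSeries (PrimeSpectrum B) => (l.length : WithBot ℕ∞)) l'

end KrullDim

/-! ### Growth of a graded module -/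

section Growth

theorem finiteDimensional_restrictDegree (k : Type*) [Field k] (s n : ℕ) :
    FiniteDimensional k (MvPolynomial.restrictDegree (Fin s) k n) ∧
    Module.finrank k (MvPolynomial.restrictDegree (Fin s) k n) = (n + 1) ^ s := by
  classical
  let e : {m : Fin s →₀ ℕ | ∀ i, m i ≤ n} ≃ (Fin s → Fin (n + 1)) :=
    { toFun := fun m i => ⟨m.1 i, Nat.lt_succ_of_le (m.2 i)⟩
      invFun := fun f => ⟨Finsupp.equivFunOnFinite.symm fun i => (f i : ℕ), fun i =>
        Nat.le_of_lt_succ (f i).2⟩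
      left_inv := fun m => by ext i; simp
      right_inv := fun f => by ext i; simp }
  let B := (MvPolynomial.basisRestrictSupport k {m : Fin s →₀ ℕ | ∀ i, m i ≤ n}).reindex e
  exact ⟨Module.Finite.of_basis B, (Module.finrank_eq_card_basis B).trans (by simp)⟩

theorem finiteDimensional_restrictTotalDegree (k : Type*) [Field k] (s n : ℕ) :
    FiniteDimensional k (MvPolynomial.restrictTotalDegree (Fin s) k n) ∧
    Module.finrank k (MvPolynomial.restrictTotalDegree (Fin s) k n) ≤ (n + 1) ^ s := by
  obtain ⟨h1, h2⟩ := finiteDimensional_restrictDegree k s n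
  have hle := MvPolynomial.restrictTotalDegree_le_restrictDegree (σ := Fin s) k n
  exact ⟨Submodule.finiteDimensional_of_le hle, h2 ▸ Submodule.finrank_mono hle⟩

variable {k R M : Type*} [Field k] [CommRing R] [Algebra k R]
  [AddCommGroup M] [Module k M] [Module R M] [IsScalarTower k R M]
  {𝒜 : ℕ → Submodule k R} {ℳ : ℤ → Submodule k M}

/-- Noether normalization for modules: `M` is finite over a polynomial ring in `dim M` variables
which acts faithfully. -/
theorem exists_noether_normalization (k R M : Type*) [Field k] [CommRing R] [Algebra k R]
    [AddCommGroup M] [Module R M]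
    [Algebra.FiniteType k R] [Nontrivial M] [Module.Finite R M] :
    ∃ (s : ℕ) (φ : MvPolynomial (Fin s) k →ₐ[k] R) (r : ℕ) (v : Fin r → M),
      Module.supportDim R M = s ∧ (∀ p, φ p ∈ Module.annihilator R M → p = 0) ∧
      ∀ m, ∃ p : Fin r → MvPolynomial (Fin s) k, ∑ i, φ (p i) • v i = m := by
  let I := Module.annihilator R M
  have hI : I ≠ ⊤ := fun h => by
    obtain ⟨m, hm⟩ := exists_ne (0 : M)
    exact hm (by simpa using Module.mem_annihilator.1 (h ▸ trivial : (1 : R) ∈ I) m)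
  have : Nontrivial (R ⧸ I) := Ideal.Quotient.nontrivial_iff.2 hI
  have : Algebra.FiniteType k (R ⧸ I) :=
    Algebra.FiniteType.of_surjective (Ideal.Quotient.mkₐ k I) Ideal.Quotient.mk_surjective
  obtain ⟨s, g, hg, hfin⟩ := exists_finite_inj_algHom_of_fg k (R ⧸ I)
  choose Y hY using fun i => Ideal.Quotient.mk_surjective (I := I) (g (MvPolynomial.X i))
  let φ : MvPolynomial (Fin s) k →ₐ[k] R := MvPolynomial.aeval Y
  have hφ : ∀ p, Ideal.Quotient.mk I (φ p) = g p := by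
    have : (Ideal.Quotient.mkₐ k I).comp φ = g := by
      ext i
      simp [φ, hY]
    exact fun p => DFunLike.congr_fun this p
  let _ : Algebra (MvPolynomial (Fin s) k) (R ⧸ I) := g.toRingHom.toAlgebra
  let _ : Module (R ⧸ I) M := Module.quotientAnnihilator
  let _ : Module (MvPolynomial (Fin s) k) M := Module.compHom M g.toRingHom
  have : IsScalarTower (MvPolynomial (Fin s) k) (R ⧸ I) M :=
    ⟨fun a b m => mul_smul (g a) b m⟩
  have : IsScalarTower R (R ⧸ I) M := ⟨fun a b m => by
    obtain ⟨b, rfl⟩ := Ideal.Quotient.mk_surjective b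
    exact mul_smul a b m⟩
  have : Module.Finite (MvPolynomial (Fin s) k) (R ⧸ I) := hfin
  have : Module.Finite (R ⧸ I) M := Module.Finite.of_restrictScalars_finite R _ _
  have : Module.Finite (MvPolynomial (Fin s) k) M := Module.Finite.trans (R ⧸ I) M
  obtain ⟨r, v, hv⟩ := Module.Finite.exists_fin (R := MvPolynomial (Fin s) k) (M := M)
  refine ⟨s, φ, r, v, ?_, fun p hp => ?_, fun m => ?_⟩
  · rw [Module.supportDim_eq_ringKrullDim_quotient_annihilator,
      ringKrullDim_eq_of_isIntegral (MvPolynomial (Fin s) k) (R ⧸ I) hg,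
      MvPolynomial.ringKrullDim_of_isNoetherianRing]
    simp
  · refine hg ?_
    rw [← hφ, map_zero]
    exact Ideal.Quotient.eq_zero_iff_mem.2 hp
  · obtain ⟨p, hp⟩ := (Submodule.mem_span_range_iff_exists_fun _).1
      (hv ▸ trivial : m ∈ Submodule.span (MvPolynomial (Fin s) k) (Set.range v))
    refine ⟨p, hp ▸ Finset.sum_congr rfl fun i _ => ?_⟩
    change φ (p i) • v i = g (p i) • v i
    rw [← hφ]
    rfl

/-- The subspace of elements all of whose components of degree more than `n` vanish. -/
def IsGradedModule.truncation (h : IsGradedModule 𝒜 ℳ) (n : ℤ) : Submodule k M where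
  carrier := {m | ∀ j, n < j → h.isInternal.component j m = 0}
  add_mem' hx hy j hj := by rw [map_add, hx j hj, hy j hj, add_zero]
  zero_mem' j _ := map_zero _
  smul_mem' c x hx j hj := by rw [map_smul, hx j hj, smul_zero]

namespace IsGradedModule

variable (h : IsGradedModule 𝒜 ℳ)

omit [IsScalarTower k R M] in
theorem truncation_mono {a b : ℤ} (hab : a ≤ b) : h.truncation a ≤ h.truncation b :=
  fun _ hm j hj => hm j (by omega)

omit [IsScalarTower k R M] in
theorem mem_truncation {j n : ℤ} (hjn : j ≤ n) {m : M} (hm : m ∈ ℳ j) : m ∈ h.truncation n :=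
  fun _ hi => h.isInternal.component_of_mem_ne (by omega) hm

omit [IsScalarTower k R M] in
theorem finrank_truncation [∀ j, FiniteDimensional k (ℳ j)] {b : ℤ} (hb : ∀ j < b, ℳ j = ⊥)
    (n : ℕ) : FiniteDimensional k (h.truncation (b + n)) ∧
    Module.finrank k (h.truncation (b + n)) =
      ∑ i ∈ Finset.range (n + 1), Module.finrank k (ℳ (b + i)) := by
  let f : h.truncation (b + n) →ₗ[k] (i : Fin (n + 1)) → ℳ (b + (i : ℕ)) :=
    LinearMap.pi fun i => ((h.isInternal.component (b + (i : ℕ))).codRestrict _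
      (h.isInternal.component_mem _)) ∘ₗ (h.truncation (b + n)).subtype
  have hf : Function.Bijective f := by
    constructor
    · rw [injective_iff_map_eq_zero]
      intro x hx
      refine Subtype.ext (h.isInternal.ext_component fun j => ?_)
      rw [ZeroMemClass.coe_zero, map_zero]
      rcases lt_or_ge j b with hj | hj
      · have := h.isInternal.component_mem j (x : M)
        rw [hb j hj] at this
        simpa using this
      · rcases lt_or_ge (b + n) j with hj' | hj'
        · exact x.2 j hj'
        · obtain ⟨i, rfl⟩ := Int.exists_add_of_le hj
          exact congrArg Subtype.val (congrFun hx ⟨i, by omega⟩)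
    · intro y
      refine ⟨⟨∑ i, (y i : M), sum_mem fun i _ => h.mem_truncation (by omega) (y i).2⟩, ?_⟩
      ext i
      change h.isInternal.component (b + (i : ℕ)) (∑ l, (y l : M)) = y i
      rw [map_sum, Finset.sum_eq_single i]
      · exact h.isInternal.component_of_mem (y i).2
      · intro l _ hl
        refine h.isInternal.component_of_mem_ne ?_ (y l).2
        simpa [Fin.ext_iff] using hl
      · simp
  have e := LinearEquiv.ofBijective f hf
  refine ⟨Module.Finite.equiv e.symm, ?_⟩
  rw [e.finrank_eq, Module.finrank_pi_fintype, Finset.sum_range]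

/-- Multiplication by an element of `R` raises degrees by a bounded amount. -/
theorem exists_smul_mem_truncation [GradedAlgebra 𝒜] (r : R) :
    ∃ D : ℕ, ∀ n, ∀ m ∈ h.truncation n, r • m ∈ h.truncation (n + D) := by
  classical
  refine DirectSum.Decomposition.inductionOn 𝒜 ⟨0, fun n m _ => ?_⟩ (fun {i} a => ⟨i, ?_⟩) ?_ r
  · rw [zero_smul]; exact zero_mem _
  · intro n m hm j hj
    have := h.component_smul a.2 (j - i) m
    rw [sub_add_cancel] at this
    rw [this, hm _ (by omega), smul_zero]
  · rintro x y ⟨D, hD⟩ ⟨E, hE⟩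
    refine ⟨D + E, fun n m hm => ?_⟩
    rw [add_smul]
    exact add_mem (h.truncation_mono (by omega) (hD n m hm))
      (h.truncation_mono (by omega) (hE n m hm))

theorem smul_mem_truncation_of_totalDegree_le {s : ℕ} (φ : MvPolynomial (Fin s) k →ₐ[k] R)
    {D : ℕ} (hD : ∀ i n, ∀ m ∈ h.truncation n, φ (MvPolynomial.X i) • m ∈ h.truncation (n + D))
    {p : MvPolynomial (Fin s) k} {d : ℕ} (hp : p.totalDegree ≤ d) {n : ℤ} {m : M}
    (hm : m ∈ h.truncation n) : φ p • m ∈ h.truncation (n + D * d) := by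
  classical
  have hpow : ∀ (i : Fin s) (e : ℕ) (n : ℤ), ∀ m ∈ h.truncation n,
      φ (MvPolynomial.X i) ^ e • m ∈ h.truncation (n + D * e) := by
    intro i e
    induction e with
    | zero => intro n m hm; simpa using hm
    | succ e ih =>
      intro n m hm
      rw [pow_succ', mul_smul]
      have := hD i _ _ (ih n m hm)
      convert this using 2
      push_cast; ring
  have hprod : ∀ (e : Fin s → ℕ) (t : Finset (Fin s)), ∀ m ∈ h.truncation n,
      (∏ i ∈ t, φ (MvPolynomial.X i) ^ e i) • m ∈ h.truncation (n + D * (∑ i ∈ t, e i : ℕ)) := by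
    intro e t
    induction t using Finset.induction_on with
    | empty => intro m hm; simpa using hm
    | insert i t hi ih =>
      intro m hm
      rw [Finset.prod_insert hi, Finset.sum_insert hi, mul_smul]
      have := hpow i (e i) _ _ (ih m hm)
      convert this using 2
      push_cast; ring
  rw [p.as_sum, map_sum, Finset.sum_smul]
  refine sum_mem fun α hα => ?_
  have hα' : ∑ i, α i ≤ d := by
    have := MvPolynomial.le_totalDegree hα
    rw [Finsupp.sum_fintype _ _ (fun _ => rfl)] at this
    exact this.trans hp
  rw [MvPolynomial.monomial_eq, map_mul, mul_smul, ← MvPolynomial.algebraMap_eq, AlgHom.commutes,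
    algebraMap_smul, Finsupp.prod_fintype _ _ (fun _ => pow_zero _), map_prod]
  simp only [map_pow]
  refine Submodule.smul_mem _ _ (h.truncation_mono ?_ (hprod α Finset.univ m hm))
  have : (∑ i, α i : ℕ) ≤ (d : ℤ) := by exact_mod_cast hα'
  nlinarith

/-- The dimension `s` of a graded module is the exponent of growth of the sums of the dimensions of
its homogeneous components. For the upper bound, the elements of degree at most `b + n` are
combinations of the generators `v` from `exists_noether_normalization` with coefficients of total
degree at most a multiple of `n + 1`. For the lower bound, the `(n + 1) ^ s`-dimensional space of
polynomials of degree at most `n` in each variable embeds, by its action on homogeneous generators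
of `M`, into a power of the space of elements of degree at most `b + D * n + c`. The normalization
need not be compatible with the grading. -/
theorem exists_growth (h : IsGradedModule 𝒜 ℳ) [GradedAlgebra 𝒜] (h𝒜 : 𝒜 0 = 1)
    [Algebra.FiniteType k R] [Nontrivial M] [Module.Finite R M] :
    (∀ j, FiniteDimensional k (ℳ j)) ∧ ∃ s : ℕ, Module.supportDim R M = s ∧
    ∃ b : ℤ, (∀ j < b, ℳ j = ⊥) ∧ ∃ C D c : ℕ, 0 < D ∧
      (∀ n, ∑ i ∈ Finset.range (n + 1), Module.finrank k (ℳ (b + i)) ≤ C * (n + 1) ^ s) ∧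
      ∀ n, (n + 1) ^ s ≤
        C * ∑ i ∈ Finset.range (D * n + c + 1), Module.finrank k (ℳ (b + i)) := by
  classical
  obtain ⟨S, hS, hS'⟩ := exists_homogeneous_algebra_generators 𝒜 h𝒜
  obtain ⟨G, hGℳ, hG⟩ := h.exists_homogeneous_generators
  obtain ⟨b, hb⟩ := (G.image Prod.fst).bddBelow
  replace hb : ∀ p ∈ G, b ≤ p.1 := fun p hp => hb (by simpa using ⟨p.2, hp⟩)
  have hbot : ∀ j < b, ℳ j = ⊥ := fun j hj => h.eq_bot_of_lt_generators hS hS' hG hGℳ hb hj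
  obtain ⟨s, φ, r, v, hs, hinj, hv⟩ := exists_noether_normalization k R M
  -- The image of the polynomials of degree at most `n` acting on the generators `v`.
  let Ψ : (n : ℕ) → (Fin r → MvPolynomial.restrictTotalDegree (Fin s) k n) →ₗ[k] M := fun n =>
    ∑ i, ((LinearMap.toSpanSingleton R M (v i)).restrictScalars k) ∘ₗ φ.toLinearMap ∘ₗ
      (MvPolynomial.restrictTotalDegree (Fin s) k n).subtype ∘ₗ LinearMap.proj i
  have hΨ : ∀ n p, Ψ n p = ∑ i, φ (p i) • v i := fun n p => by simp [Ψ]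
  let W : ℕ → Submodule k M := fun n => LinearMap.range (Ψ n)
  have hWfin : ∀ n, FiniteDimensional k (W n) ∧ Module.finrank k (W n) ≤ r * (n + 1) ^ s := by
    intro n
    obtain ⟨h1, h2⟩ := finiteDimensional_restrictTotalDegree k s n
    refine ⟨inferInstance, (LinearMap.finrank_range_le _).trans ?_⟩
    rw [Module.finrank_pi_fintype]
    simpa using Nat.mul_le_mul_left r h2
  have hWmem : ∀ {n} {p : MvPolynomial (Fin s) k} (i : Fin r), p.totalDegree ≤ n →
      φ p • v i ∈ W n := by
    intro n p i hp
    refine ⟨Pi.single i ⟨p, (MvPolynomial.mem_restrictTotalDegree _ _ _).2 hp⟩, ?_⟩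
    rw [hΨ, Finset.sum_eq_single i]
    · simp
    · intro l _ hl; simp [Pi.single_eq_of_ne hl]
    · simp
  have hWmem' : ∀ {n} (p : Fin r → MvPolynomial (Fin s) k), (∀ i, (p i).totalDegree ≤ n) →
      ∑ i, φ (p i) • v i ∈ W n := fun p hp => sum_mem fun i _ => hWmem i (hp i)
  have hWmono : ∀ {a b : ℕ}, a ≤ b → W a ≤ W b := by
    rintro a b hab _ ⟨p, rfl⟩
    rw [hΨ]
    exact hWmem' _ fun i => ((MvPolynomial.mem_restrictTotalDegree _ _ _).1 (p i).2).trans hab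
  have hex : ∀ m, ∃ n, m ∈ W n := by
    intro m
    obtain ⟨p, rfl⟩ := hv m
    exact ⟨_, hWmem' p fun i => Finset.le_sup (f := fun i => (p i).totalDegree) (Finset.mem_univ i)⟩
  choose e he using hex
  -- A common bound for the polynomials expressing generators, and generators times generators.
  obtain ⟨E, hE1, hE2⟩ : ∃ E, (∀ p ∈ G, p.2 ∈ W E) ∧ ∀ x ∈ S, ∀ i, x • v i ∈ W E := by
    refine ⟨(G.sup fun p => e p.2) + S.sup fun x => Finset.univ.sup fun i => e (x • v i),
      fun p hp => ?_, fun x hx i => ?_⟩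
    · exact hWmono (le_add_right (Finset.le_sup (f := fun p : ℤ × M => e p.2) hp)) (he _)
    · refine hWmono (le_add_left (le_trans ?_ (Finset.le_sup
        (f := fun x => Finset.univ.sup fun i => e (x • v i)) hx))) (he _)
      exact Finset.le_sup (f := fun i => e (x • v i)) (Finset.mem_univ i)
  have hWsmul : ∀ x ∈ S, ∀ n, ∀ m ∈ W n, x • m ∈ W (n + E) := by
    rintro x hx n _ ⟨p, rfl⟩
    rw [hΨ, Finset.smul_sum]
    refine sum_mem fun i _ => ?_
    obtain ⟨q, hq⟩ := hE2 x hx i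
    rw [smul_comm, ← hq, hΨ, Finset.smul_sum]
    refine sum_mem fun l _ => ?_
    rw [smul_smul, ← map_mul]
    exact hWmem l ((MvPolynomial.totalDegree_mul _ _).trans (add_le_add
      ((MvPolynomial.mem_restrictTotalDegree _ _ _).1 (p i).2)
      ((MvPolynomial.mem_restrictTotalDegree _ _ _).1 (q l).2)))
  -- The algebra generators in `S` raise the index of `W` by `E`, and the degree by at least one.
  have hupper : ∀ j, ℳ j ≤ W (E * (j - b + 1).toNat) := by
    intro j
    have := h.le_of_generators hS hG
      (fun j => if j < b then ⊥ else W (E * (j - b + 1).toNat)) hGℳ (fun p hp => ?_)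
      (fun x hx => ?_) j
    · refine this.trans ?_
      split_ifs
      · exact bot_le
      · exact le_rfl
    · rw [if_neg (not_lt.2 (hb p hp))]
      refine hWmono (Nat.le_mul_of_pos_right _ ?_) (hE1 p hp)
      have := hb p hp
      omega
    · obtain ⟨d, hd, hxd⟩ := hS' x hx
      refine ⟨d, hxd, fun j m hm => ?_⟩
      by_cases hj : j < b
      · simp only [hj, if_true, Submodule.mem_bot] at hm
        simp [hm]
      · rw [if_neg (by omega)]
        rw [if_neg hj] at hm
        refine hWmono ?_ (hWsmul x hx _ m hm)
        rw [← Nat.mul_succ]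
        exact Nat.mul_le_mul_left E (by omega)
  have hfin : ∀ j, FiniteDimensional k (ℳ j) := fun j =>
    have := (hWfin (E * (j - b + 1).toNat)).1
    Submodule.finiteDimensional_of_le (hupper j)
  have hT := fun n => h.finrank_truncation hbot n
  refine ⟨hfin, s, hs, b, hbot, ?_⟩
  choose D hD using fun i => h.exists_smul_mem_truncation (φ (MvPolynomial.X i))
  obtain ⟨c, hc⟩ : ∃ c : ℕ, ∀ p ∈ G, p.1 ≤ b + c := by
    refine ⟨G.sup fun p => (p.1 - b).toNat, fun p hp => ?_⟩
    have := Finset.le_sup (f := fun p : ℤ × M => (p.1 - b).toNat) hp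
    omega
  let D' := Finset.univ.sup D
  have hD' : ∀ i n, ∀ m ∈ h.truncation n,
      φ (MvPolynomial.X i) • m ∈ h.truncation (n + D') := fun i n m hm =>
    h.truncation_mono (by
      have : D i ≤ D' := Finset.le_sup (Finset.mem_univ i)
      omega) (hD i n m hm)
  -- The constant `C` has a summand for each of the two bounds. The factor `D' * s` comes from the
  -- total degree `s * n` of the polynomials in the lower bound; adding one makes it positive.
  refine ⟨r * (E + 1) ^ s + G.card, D' * s + 1, c, Nat.succ_pos _, fun n => ?_, fun n => ?_⟩
  · rw [← (hT n).2]
    have hle : h.truncation (b + n) ≤ W (E * (n + 1)) := by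
      intro m hm
      obtain ⟨t, ht, -⟩ := h.isInternal.exists_sum_component m
      rw [← ht]
      refine sum_mem fun j _ => ?_
      rcases lt_or_ge (b + n) j with hj | hj
      · rw [hm j hj]; exact zero_mem _
      · exact hWmono (Nat.mul_le_mul_left E (by omega)) (hupper j (h.isInternal.component_mem j m))
    have := (hWfin (E * (n + 1))).1
    refine (Submodule.finrank_mono hle).trans ((hWfin _).2.trans ?_)
    have h1 : (E * (n + 1) + 1) ^ s ≤ ((E + 1) * (n + 1)) ^ s :=
      Nat.pow_le_pow_left (by nlinarith) s
    rw [mul_pow] at h1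
    nlinarith [Nat.zero_le (G.card * (n + 1) ^ s)]
  · have hT' := hT ((D' * s + 1) * n + c)
    rw [← hT'.2]
    have := hT'.1
    obtain ⟨h1, h2⟩ := finiteDimensional_restrictDegree k s n
    -- The action on the homogeneous generators `G`; it is injective since the action on `M` is
    -- faithful.
    let Θ : MvPolynomial.restrictDegree (Fin s) k n →ₗ[k]
        (G → h.truncation (b + ((D' * s + 1) * n + c : ℕ))) :=
      LinearMap.pi fun p => (((LinearMap.toSpanSingleton R M p.1.2).restrictScalars k) ∘ₗ
        φ.toLinearMap ∘ₗ (MvPolynomial.restrictDegree (Fin s) k n).subtype).codRestrict _ (by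
          intro q
          have hq : (q : MvPolynomial (Fin s) k).totalDegree ≤ s * n := by
            refine Finset.sup_le fun α hα => ?_
            rw [Finsupp.sum_fintype _ _ (fun _ => rfl)]
            have := (MvPolynomial.mem_restrictDegree _ _ _).1 q.2 α hα
            exact (Finset.sum_le_card_nsmul _ _ n fun i _ => this i).trans (by simp)
          have := h.smul_mem_truncation_of_totalDegree_le φ hD' hq
            (h.mem_truncation (hc p.1 p.2) (hGℳ p.1 p.2))
          refine h.truncation_mono ?_ this
          push_cast
          nlinarith)
    have hΘ : Function.Injective Θ := by
      rw [injective_iff_map_eq_zero]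
      intro q hq
      refine Subtype.ext (hinj _ ?_)
      rw [Module.mem_annihilator]
      intro m
      have hm : m ∈ Submodule.span R (Prod.snd '' (G : Set (ℤ × M))) := by rw [hG]; trivial
      induction hm using Submodule.span_induction with
      | mem x hx =>
        obtain ⟨p, hp, rfl⟩ := hx
        exact congrArg Subtype.val (congrFun hq ⟨p, hp⟩)
      | zero => simp
      | add x y _ _ hx hy => rw [smul_add, hx, hy, add_zero]
      | smul a x _ hx => rw [smul_comm, hx, smul_zero]
    have := LinearMap.finrank_le_finrank_of_injective hΘ
    rw [h2, Module.finrank_pi_fintype] at this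
    simp only [Finset.sum_const, Finset.card_univ, Fintype.card_coe, smul_eq_mul] at this
    nlinarith [Nat.zero_le (r * (E + 1) ^ s * Module.finrank k
      (h.truncation (b + ((D' * s + 1) * n + c : ℕ))))]

end IsGradedModule

end Growth

/-! ### Rational generating functions and growth of coefficients -/

section Asymptotics

open Polynomial Filter Topology

theorem Nat.add_choose_self_le_pow (n s : ℕ) : (n + s).choose s ≤ (n + 1) ^ s := by
  induction s with
  | zero => simp
  | succ s ih =>
    have h := Nat.add_one_mul_choose_eq (n + s) s
    have h1 : (n + s + 1) ≤ (n + 1) * (s + 1) := by nlinarith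
    have : (n + (s + 1)).choose (s + 1) * (s + 1) ≤ (n + 1) ^ (s + 1) * (s + 1) := by
      rw [← add_assoc, ← h, pow_succ]
      calc (n + s + 1) * (n + s).choose s ≤ ((n + 1) * (s + 1)) * (n + 1) ^ s :=
            Nat.mul_le_mul h1 ih
        _ = _ := by ring
    exact Nat.le_of_mul_le_mul_right this (Nat.succ_pos s)

theorem Nat.pow_le_factorial_mul_add_choose (n s : ℕ) :
    (n + 1) ^ s ≤ s.factorial * (n + s).choose s := by
  rw [← Nat.ascFactorial_eq_factorial_mul_choose]
  exact Nat.pow_succ_le_ascFactorial (n + 1) s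

variable {a : ℕ → ℕ} {s C D c : ℕ}

/-- The upper bound for the generating function comes from the comparison of `(n + 1) ^ s` with
`(n + s).choose s`, whose generating function is `1 / (1 - t) ^ (s + 1)`. -/
theorem summable_of_growth (hC : ∀ n, a n ≤ C * (n + 1) ^ s) {t : ℝ} (h0 : 0 < t) (h1 : t < 1) :
    Summable (fun n => (a n : ℝ) * t ^ n) ∧
      (∑' n, (a n : ℝ) * t ^ n) * (1 - t) ^ (s + 1) ≤ C * s.factorial := by
  have hn : ‖t‖ < 1 := by rwa [Real.norm_of_nonneg h0.le]
  have hS := (summable_choose_mul_geometric_of_norm_lt_one s hn).mul_left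
    ((C * s.factorial : ℕ) : ℝ)
  have hle : ∀ n, (a n : ℝ) * t ^ n ≤
      ((C * s.factorial : ℕ) : ℝ) * (((n + s).choose s : ℝ) * t ^ n) := by
    intro n
    rw [← mul_assoc]
    refine mul_le_mul_of_nonneg_right ?_ (pow_nonneg h0.le n)
    have := (hC n).trans (Nat.mul_le_mul_left C (Nat.pow_le_factorial_mul_add_choose n s))
    rw [← mul_assoc] at this
    exact_mod_cast this
  have hS' := Summable.of_nonneg_of_le (fun n => by positivity) hle hS
  refine ⟨hS', ?_⟩
  have := hS'.tsum_le_tsum hle hS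
  rw [tsum_mul_left, tsum_choose_mul_geometric_of_norm_lt_one s hn] at this
  have hpos : (0 : ℝ) < (1 - t) ^ (s + 1) := pow_pos (by linarith) _
  calc _ ≤ ((C * s.factorial : ℕ) : ℝ) * (1 / (1 - t) ^ (s + 1)) * (1 - t) ^ (s + 1) :=
        mul_le_mul_of_nonneg_right this hpos.le
    _ = _ := by field_simp; push_cast; ring

/-- The lower bound for the generating function comes from the coefficients with index in
`D * ℕ + c`, together with Bernoulli's inequality `1 - t ^ D ≤ D * (1 - t)`. -/
theorem le_tsum_of_growth (hC : ∀ n, a n ≤ C * (n + 1) ^ s) (hD : 0 < D)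
    (hD' : ∀ n, (n + 1) ^ s ≤ C * a (D * n + c)) {t : ℝ} (h0 : 0 < t) (h1 : t < 1) :
    t ^ c ≤ (C * D ^ (s + 1)) * ((∑' n, (a n : ℝ) * t ^ n) * (1 - t) ^ (s + 1)) := by
  have hS := (summable_of_growth hC h0 h1).1
  have htD : t ^ D < 1 := pow_lt_one₀ h0.le h1 hD.ne'
  have hn : ‖t ^ D‖ < 1 := by rwa [Real.norm_of_nonneg (pow_nonneg h0.le D)]
  have hinj : Function.Injective fun n : ℕ => D * n + c := fun x y hxy => by
    have : D * x = D * y := by simpa using hxy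
    exact Nat.eq_of_mul_eq_mul_left hD this
  have hsub := (hS.comp_injective hinj).tsum_le_tsum_of_inj (g := fun n => (a n : ℝ) * t ^ n)
    (fun n : ℕ => D * n + c) hinj (fun _ _ => by positivity) (fun _ => le_rfl) hS
  have hlow := ((summable_choose_mul_geometric_of_norm_lt_one s hn).mul_left (t ^ c)).tsum_le_tsum
    (g := fun n : ℕ => C * ((a (D * n + c) : ℝ) * t ^ (D * n + c))) (fun n => by
      have h2 : ((n + s).choose s : ℝ) ≤ C * a (D * n + c) := by
        exact_mod_cast (Nat.add_choose_self_le_pow n s).trans (hD' n)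
      have : (0 : ℝ) ≤ t ^ c * (t ^ D) ^ n := by positivity
      calc t ^ c * (((n + s).choose s : ℝ) * (t ^ D) ^ n)
          = ((n + s).choose s : ℝ) * (t ^ c * (t ^ D) ^ n) := by ring
        _ ≤ (C * a (D * n + c)) * (t ^ c * (t ^ D) ^ n) := mul_le_mul_of_nonneg_right h2 this
        _ = _ := by rw [pow_add, pow_mul]; ring) ((hS.comp_injective hinj).mul_left _)
  rw [tsum_mul_left, tsum_mul_left, tsum_choose_mul_geometric_of_norm_lt_one s hn] at hlow
  have hF : t ^ c * (1 / (1 - t ^ D) ^ (s + 1)) ≤ C * ∑' n, (a n : ℝ) * t ^ n :=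
    hlow.trans (mul_le_mul_of_nonneg_left hsub (Nat.cast_nonneg C))
  have hpos : (0 : ℝ) < (1 - t ^ D) ^ (s + 1) := pow_pos (by linarith) _
  have hbern : 1 - t ^ D ≤ D * (1 - t) := by
    have := one_add_mul_le_pow (a := t - 1) (by linarith) D
    rw [add_sub_cancel] at this
    linarith
  have hpow : (1 - t ^ D) ^ (s + 1) ≤ D ^ (s + 1) * (1 - t) ^ (s + 1) := by
    rw [← mul_pow]
    exact pow_le_pow_left₀ (by linarith) hbern _
  rw [mul_one_div, div_le_iff₀ hpos] at hF
  have hnn : (0 : ℝ) ≤ C * ∑' n, (a n : ℝ) * t ^ n :=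
    mul_nonneg (Nat.cast_nonneg C) (tsum_nonneg fun n => by positivity)
  calc t ^ c ≤ _ := hF
    _ ≤ (C * ∑' n, (a n : ℝ) * t ^ n) * (D ^ (s + 1) * (1 - t) ^ (s + 1)) :=
      mul_le_mul_of_nonneg_left hpow hnn
    _ = _ := by ring

theorem Polynomial.tsum_coeff_mul_pow (p : ℚ[X]) (t : ℝ) :
    Summable (fun n => ‖(p.coeff n : ℝ) * t ^ n‖) ∧
      ∑' n, (p.coeff n : ℝ) * t ^ n = aeval t p := by
  have hz : ∀ n ∉ Finset.range (p.natDegree + 1), (p.coeff n : ℝ) * t ^ n = 0 := by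
    intro n hn
    rw [p.coeff_eq_zero_of_natDegree_lt (by simpa using hn)]
    simp
  refine ⟨summable_of_ne_finset_zero (s := Finset.range (p.natDegree + 1)) fun n hn => by
    rw [hz n hn, norm_zero], ?_⟩
  rw [tsum_eq_sum hz, aeval_eq_sum_range]
  simp [Algebra.smul_def]

/-- Evaluating an identity `A * q = p` of power series, where `A` has coefficients `a n`. -/
theorem tsum_mul_aeval_eq {p q : ℚ[X]}
    (h : PowerSeries.mk (fun n => (a n : ℚ)) * (q : PowerSeries ℚ) = p) {t : ℝ} (ht : 0 < t)
    (hS : Summable fun n => (a n : ℝ) * t ^ n) :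
    (∑' n, (a n : ℝ) * t ^ n) * aeval t q = aeval t p := by
  have hS' : Summable fun n => ‖(a n : ℝ) * t ^ n‖ := by
    refine hS.congr fun n => (Real.norm_of_nonneg (by positivity)).symm
  rw [← (q.tsum_coeff_mul_pow t).2, ← (p.tsum_coeff_mul_pow t).2,
    tsum_mul_tsum_eq_tsum_sum_antidiagonal_of_summable_norm hS' (q.tsum_coeff_mul_pow t).1]
  refine tsum_congr fun n => ?_
  have hc := congrArg (PowerSeries.coeff n) h
  rw [PowerSeries.coeff_mul, Polynomial.coeff_coe] at hc
  rw [← hc]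
  push_cast
  rw [Finset.sum_mul]
  refine Finset.sum_congr rfl fun x hx => ?_
  rw [← Finset.HasAntidiagonal.mem_antidiagonal.1 hx, pow_add]
  rw [PowerSeries.coeff_mk, Rat.cast_natCast]
  ring

/-- If the coefficients `a n` of a rational function grow like `n ^ s`, then the function has a
pole of order `s + 1` at `1`, with a positive leading coefficient: after multiplication by
`(1 - t) ^ (s + 1)` the function is bounded above and bounded away from zero as `t` tends to `1`
from below. -/
theorem exists_pos_eval_one_of_growth {p q : ℚ[X]} (hq : q ≠ 0)
    (h : PowerSeries.mk (fun n => (a n : ℚ)) * (q : PowerSeries ℚ) = p)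
    (hC : ∀ n, a n ≤ C * (n + 1) ^ s) (hD : 0 < D)
    (hD' : ∀ n, (n + 1) ^ s ≤ C * a (D * n + c)) :
    ∃ u v : ℚ[X], 0 < u.eval 1 ∧ 0 < v.eval 1 ∧ u * q = v * (p * (1 - X) ^ (s + 1)) := by
  obtain ⟨u, v, hco, huv⟩ : ∃ u v : ℚ[X], IsCoprime u v ∧
      u * q = v * (p * (1 - X) ^ (s + 1)) := by
    let f : RatFunc ℚ := algebraMap ℚ[X] _ (p * (1 - X) ^ (s + 1)) / algebraMap ℚ[X] _ q
    refine ⟨f.num, f.denom, f.isCoprime_num_denom, ?_⟩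
    rw [mul_comm f.denom]
    exact (RatFunc.num_mul_eq_mul_denom_iff hq).2 rfl
  have hqmap : q.map (algebraMap ℚ ℝ) ≠ 0 :=
    (Polynomial.map_ne_zero_iff (algebraMap ℚ ℝ).injective).2 hq
  have hroots : ∀ᶠ t in 𝓝[<] (1 : ℝ), aeval t q ≠ 0 := by
    have hfin : ({t : ℝ | aeval t q = 0} \ {1}).Finite := by
      refine Set.Finite.subset (q.map (algebraMap ℚ ℝ)).roots.toFinset.finite_toSet ?_
      intro t ht
      simpa [hqmap, Polynomial.eval_map_algebraMap, hq] using ht.1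
    have hmem : ({t : ℝ | aeval t q = 0} \ {1})ᶜ ∈ 𝓝 (1 : ℝ) :=
      hfin.isClosed.isOpen_compl.mem_nhds (by simp)
    filter_upwards [mem_nhdsWithin_of_mem_nhds hmem, self_mem_nhdsWithin] with t ht ht1 h0
    exact ht ⟨h0, ne_of_lt ht1⟩
  have hIoo : ∀ᶠ t in 𝓝[<] (1 : ℝ), 0 < t ∧ t < 1 := Ioo_mem_nhdsLT one_pos
  -- `Φ` is the value of the generating function at `t`, multiplied by `(1 - t) ^ (s + 1)`.
  have key : ∀ᶠ t in 𝓝[<] (1 : ℝ), ∃ Φ : ℝ, 0 ≤ Φ ∧ Φ ≤ C * s.factorial ∧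
      t ^ c ≤ (C * D ^ (s + 1)) * Φ ∧ aeval t u = aeval t v * Φ := by
    filter_upwards [hroots, hIoo] with t hqt ht
    obtain ⟨hS, hle⟩ := summable_of_growth hC ht.1 ht.2
    refine ⟨_, ?_, hle, le_tsum_of_growth hC hD hD' ht.1 ht.2, ?_⟩
    · exact mul_nonneg (tsum_nonneg fun n => mul_nonneg (Nat.cast_nonneg _) (pow_nonneg ht.1.le _))
        (pow_nonneg (by linarith [ht.2]) _)
    · have h1 := congrArg (aeval t) huv
      simp only [map_mul, map_pow, map_sub, map_one, aeval_X] at h1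
      rw [← tsum_mul_aeval_eq h ht.1 hS] at h1
      exact mul_right_cancel₀ hqt (h1.trans (by ring))
  have hcont : ∀ f : ℚ[X], Tendsto (fun t : ℝ => aeval t f) (𝓝[<] 1) (𝓝 (aeval (1 : ℝ) f)) :=
    fun f => (f.continuous_aeval.tendsto 1).mono_left nhdsWithin_le_nhds
  have hpowc : Tendsto (fun t : ℝ => t ^ c) (𝓝[<] 1) (𝓝 (1 ^ c)) :=
    ((continuous_pow c).tendsto 1).mono_left nhdsWithin_le_nhds
  have hle1 : |aeval (1 : ℝ) u| ≤ C * s.factorial * |aeval (1 : ℝ) v| := by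
    refine le_of_tendsto_of_tendsto (hcont u).abs ((hcont v).abs.const_mul _) ?_
    filter_upwards [key] with t ht
    obtain ⟨Φ, h0, h1, -, h3⟩ := ht
    rw [h3, abs_mul, abs_of_nonneg h0, mul_comm]
    exact mul_le_mul_of_nonneg_right h1 (abs_nonneg _)
  have hle2 : 1 ^ c * |aeval (1 : ℝ) v| ≤ (C * D ^ (s + 1)) * |aeval (1 : ℝ) u| := by
    refine le_of_tendsto_of_tendsto (hpowc.mul (hcont v).abs) ((hcont u).abs.const_mul _) ?_
    filter_upwards [key] with t ht
    obtain ⟨Φ, h0, -, h2, h3⟩ := ht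
    rw [h3, abs_mul, abs_of_nonneg h0]
    calc _ ≤ (C * D ^ (s + 1) * Φ) * |aeval t v| := mul_le_mul_of_nonneg_right h2 (abs_nonneg _)
      _ = _ := by ring
  have hle3 : 0 ≤ aeval (1 : ℝ) u * aeval (1 : ℝ) v := by
    refine ge_of_tendsto ((hcont u).mul (hcont v)) ?_
    filter_upwards [key] with t ht
    obtain ⟨Φ, h0, -, -, h3⟩ := ht
    rw [h3]
    nlinarith [mul_nonneg h0 (mul_self_nonneg (aeval t v))]
  have hcast : ∀ f : ℚ[X], aeval (1 : ℝ) f = ((f.eval 1 : ℚ) : ℝ) := fun f => by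
    have := aeval_algebraMap_apply ℝ (1 : ℚ) f
    simpa using this
  have hcop : ¬ (aeval (1 : ℝ) u = 0 ∧ aeval (1 : ℝ) v = 0) := by
    rintro ⟨h1, h2⟩
    obtain ⟨x, y, hxy⟩ := hco
    have := congrArg (aeval (1 : ℝ)) hxy
    simp [h1, h2] at this
  -- By `hle1` and `hle2`, if one of the coprime polynomials `u` and `v` vanishes at `1`, so does
  -- the other one.
  have hu : aeval (1 : ℝ) u ≠ 0 := fun h0 => hcop ⟨h0, by
    rw [h0] at hle2
    simpa using hle2⟩
  have hv : aeval (1 : ℝ) v ≠ 0 := fun h0 => hcop ⟨by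
    rw [h0] at hle1
    simpa using hle1, h0⟩
  have hpos := lt_of_le_of_ne hle3 (mul_ne_zero hu hv).symm
  rw [hcast, hcast] at hpos
  have hpos : 0 < u.eval 1 * v.eval 1 := by exact_mod_cast hpos
  rcases pos_and_pos_or_neg_and_neg_of_mul_pos hpos with ⟨h1, h2⟩ | ⟨h1, h2⟩
  · exact ⟨u, v, h1, h2, huv⟩
  · exact ⟨-u, -v, by simpa using h1, by simpa using h2, by rw [neg_mul, neg_mul, huv]⟩

end Asymptotics

/-! ### Hilbert series -/

section LaurentSeries

open HahnSeries

theorem exists_laurentSeries_of_eq_zero (c : ℤ → ℚ) (b : ℤ) (hc : ∀ j < b, c j = 0) :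
    ∃ H : LaurentSeries ℚ, ∀ j, H.coeff j = c j :=
  ⟨HahnSeries.ofSuppBddBelow c ⟨b, fun j hj => not_lt.1 fun h => hj (hc j h)⟩, fun j =>
    congrFun HahnSeries.coeff_ofSuppBddBelow j⟩

theorem coe_ratFunc_X_zpow (b : ℤ) :
    ((RatFunc.X ^ b : RatFunc ℚ) : LaurentSeries ℚ) = single b 1 := by
  rw [map_zpow₀, RatFunc.coe_X]
  cases b with
  | ofNat n => simp [HahnSeries.single_pow]
  | negSucc n =>
    rw [zpow_negSucc, HahnSeries.single_pow, one_pow, HahnSeries.inv_single, inv_one]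
    congr 1
    simp [Int.negSucc_eq]

theorem coe_ratFunc_X_zpow_mul_coeff (b : ℤ) (H : LaurentSeries ℚ) (j : ℤ) :
    (((RatFunc.X ^ b : RatFunc ℚ) : LaurentSeries ℚ) * H).coeff j = H.coeff (j - b) := by
  rw [coe_ratFunc_X_zpow, HahnSeries.coeff_single_mul, one_mul]

theorem one_sub_X_pow_ne_zero {d : ℕ} (hd : d ≠ 0) : (1 - RatFunc.X ^ d : RatFunc ℚ) ≠ 0 := by
  intro h
  have h1 : (algebraMap (Polynomial ℚ) (RatFunc ℚ)) (1 - Polynomial.X ^ d) = 0 := by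
    rw [map_sub, map_one, map_pow, RatFunc.algebraMap_X]
    exact h
  have h2 := congrArg (Polynomial.eval 0)
    (RatFunc.algebraMap_injective ℚ (h1.trans (map_zero _).symm))
  simp [hd] at h2

theorem one_sub_X_ne_zero : (1 - RatFunc.X : RatFunc ℚ) ≠ 0 := by
  simpa using one_sub_X_pow_ne_zero one_ne_zero

/-- A rational function which is defined at `1`, with a positive value there: it is a quotient, not
necessarily in lowest terms, of polynomials with positive values at `1`. -/
def PosAtOne (e : RatFunc ℚ) : Prop :=
  ∃ u v : Polynomial ℚ, 0 < u.eval 1 ∧ 0 < v.eval 1 ∧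
    e = algebraMap (Polynomial ℚ) (RatFunc ℚ) u / algebraMap (Polynomial ℚ) (RatFunc ℚ) v

namespace PosAtOne

variable {e f : RatFunc ℚ}

theorem mul (he : PosAtOne e) (hf : PosAtOne f) : PosAtOne (e * f) := by
  obtain ⟨u, v, hu, hv, rfl⟩ := he
  obtain ⟨u', v', hu', hv', rfl⟩ := hf
  exact ⟨u * u', v * v', by simpa using mul_pos hu hu', by simpa using mul_pos hv hv', by
    rw [map_mul, map_mul, div_mul_div_comm]⟩

theorem inv (he : PosAtOne e) : PosAtOne e⁻¹ := by
  obtain ⟨u, v, hu, hv, rfl⟩ := he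
  exact ⟨v, u, hv, hu, by rw [inv_div]⟩

theorem div (he : PosAtOne e) (hf : PosAtOne f) : PosAtOne (e / f) := by
  rw [div_eq_mul_inv]
  exact he.mul hf.inv

theorem X_pow (n : ℕ) : PosAtOne (RatFunc.X ^ n) :=
  ⟨Polynomial.X ^ n, 1, by simp, by simp, by simp⟩

theorem X_zpow (n : ℤ) : PosAtOne (RatFunc.X ^ n) := by
  cases n with
  | ofNat n => simpa using X_pow n
  | negSucc n => rw [zpow_negSucc]; exact (X_pow _).inv

theorem ne_zero (he : PosAtOne e) : e ≠ 0 := by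
  obtain ⟨u, v, hu, hv, rfl⟩ := he
  refine div_ne_zero ?_ ?_
  · exact RatFunc.algebraMap_ne_zero fun h => by simp [h] at hu
  · exact RatFunc.algebraMap_ne_zero fun h => by simp [h] at hv

theorem denom_ne_zero_and_eval_pos (he : PosAtOne e) :
    e.denom.eval 1 ≠ 0 ∧ 0 < e.eval (RingHom.id ℚ) 1 := by
  obtain ⟨u, v, hu, hv, huv⟩ := he
  have hv0 : v ≠ 0 := fun h => by simp [h] at hv
  have hden : e.denom.eval 1 ≠ 0 := by
    obtain ⟨w, hw⟩ := (RatFunc.denom_dvd hv0).2 ⟨u, huv⟩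
    intro h
    rw [hw, Polynomial.eval_mul, h, zero_mul] at hv
    exact hv.false
  refine ⟨hden, ?_⟩
  have h1 := congrArg (Polynomial.eval 1) ((RatFunc.num_mul_eq_mul_denom_iff hv0).2 huv)
  rw [Polynomial.eval_mul, Polynomial.eval_mul] at h1
  have : e.eval (RingHom.id ℚ) 1 = u.eval 1 / v.eval 1 := by
    rw [RatFunc.eval, Polynomial.eval₂_id, Polynomial.eval₂_id, div_eq_div_iff hden hv.ne', h1]
  rw [this]
  exact div_pos hu hv

end PosAtOne

end LaurentSeries

section HilbertSerre

universe v

variable {k R : Type*} [Field k] [CommRing R] [Algebra k R] {𝒜 : ℕ → Submodule k R}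

/-- A Laurent series `H` is the Hilbert series of `ℳ`. This determines `H`; it is a predicate since
the Hilbert series is a Laurent series only if `ℳ` vanishes in sufficiently negative degrees. -/
def IsHilbertSeries {M : Type*} [AddCommGroup M] [Module k M] (ℳ : ℤ → Submodule k M)
    (H : LaurentSeries ℚ) : Prop :=
  ∀ j, H.coeff j = Module.finrank k (ℳ j)

theorem exists_isHilbertSeries {M : Type*} [AddCommGroup M] [Module k M]
    {ℳ : ℤ → Submodule k M} {b : ℤ} (hb : ∀ j < b, ℳ j = ⊥) :
    ∃ H, IsHilbertSeries ℳ H :=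
  exists_laurentSeries_of_eq_zero _ b fun j hj => by rw [hb j hj, finrank_bot, Nat.cast_zero]

namespace IsGradedModule

variable {M : Type v} [AddCommGroup M] [Module k M] [Module R M] [IsScalarTower k R M]
  {ℳ : ℤ → Submodule k M}

theorem finiteDimensional [GradedAlgebra 𝒜] (h𝒜 : 𝒜 0 = 1) [Algebra.FiniteType k R]
    [Module.Finite R M] (h : IsGradedModule 𝒜 ℳ) (j : ℤ) : FiniteDimensional k (ℳ j) := by
  rcases subsingleton_or_nontrivial M with _ | _
  · infer_instance
  · exact (h.exists_growth h𝒜).1 j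

theorem component_mem_ker_lsmul (h : IsGradedModule 𝒜 ℳ) {d : ℕ} {x : R} (hx : x ∈ 𝒜 d) :
    ∀ m ∈ LinearMap.ker (LinearMap.lsmul R M x), ∀ j,
      h.isInternal.component j m ∈ LinearMap.ker (LinearMap.lsmul R M x) :=
  fun _ hm j => h.smul_eq_zero_of_smul_eq_zero hx hm j

theorem component_smul_sub (h : IsGradedModule 𝒜 ℳ) {d : ℕ} {x : R} (hx : x ∈ 𝒜 d) (j : ℤ)
    (m : M) : h.isInternal.component j (x • m) = x • h.isInternal.component (j - d) m := by
  rw [← h.component_smul hx, sub_add_cancel]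

theorem component_mem_range_lsmul (h : IsGradedModule 𝒜 ℳ) {d : ℕ} {x : R} (hx : x ∈ 𝒜 d) :
    ∀ m ∈ LinearMap.range (LinearMap.lsmul R M x), ∀ j,
      h.isInternal.component j m ∈ LinearMap.range (LinearMap.lsmul R M x) := by
  rintro _ ⟨m, rfl⟩ j
  exact ⟨_, (h.component_smul_sub hx j m).symm⟩

/-- Dimension count in the exact sequence `0 → K → M → M → M/xM → 0`, where `K` is the kernel
of multiplication by the homogeneous element `x`. -/
theorem finrank_add_finrank_ker_lsmul (h : IsGradedModule 𝒜 ℳ) {d : ℕ} {x : R} (hx : x ∈ 𝒜 d)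
    [∀ j, FiniteDimensional k (ℳ j)] (j : ℤ) :
    Module.finrank k (ℳ j) +
        Module.finrank k (subGrading ℳ (LinearMap.ker (LinearMap.lsmul R M x)) (j - d)) =
      Module.finrank k (quotGrading ℳ (LinearMap.range (LinearMap.lsmul R M x)) j) +
        Module.finrank k (ℳ (j - d)) := by
  let f : ℳ (j - d) →ₗ[k] ℳ j := (smulMap k M x).restrict fun m hm => by
    have := h.smul_mem hx hm
    rwa [add_sub_cancel] at this
  let g : ℳ j →ₗ[k] M ⧸ LinearMap.range (LinearMap.lsmul R M x) :=
    ((LinearMap.range (LinearMap.lsmul R M x)).mkQ.restrictScalars k) ∘ₗ (ℳ j).subtype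
  have hg : LinearMap.range g =
      quotGrading ℳ (LinearMap.range (LinearMap.lsmul R M x)) j := by
    rw [LinearMap.range_comp, Submodule.range_subtype]
    rfl
  have hker : LinearMap.ker g = LinearMap.range f := by
    ext m
    constructor
    · intro hm
      obtain ⟨m', hm'⟩ := (Submodule.Quotient.mk_eq_zero _).1
        (show Submodule.Quotient.mk (m : M) = 0 from hm)
      refine ⟨⟨h.isInternal.component (j - d) m', h.isInternal.component_mem _ _⟩, Subtype.ext ?_⟩
      change x • h.isInternal.component (j - d) m' = m
      rw [← h.component_smul_sub hx]
      change x • m' = m at hm'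
      rw [hm', h.isInternal.component_of_mem m.2]
    · rintro ⟨m', rfl⟩
      exact (Submodule.Quotient.mk_eq_zero _).2 ⟨_, rfl⟩
  have e : LinearMap.ker f ≃ₗ[k]
      subGrading ℳ (LinearMap.ker (LinearMap.lsmul R M x)) (j - d) :=
    { toFun := fun m => ⟨⟨m.1.1, congrArg Subtype.val m.2⟩, m.1.2⟩
      invFun := fun m => ⟨⟨m.1.1, m.2⟩, Subtype.ext m.1.2⟩
      map_add' := fun _ _ => rfl
      map_smul' := fun _ _ => rfl
      left_inv := fun _ => rfl
      right_inv := fun _ => rfl }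
  have h1 := f.finrank_range_add_finrank_ker
  have h2 := g.finrank_range_add_finrank_ker
  rw [hg, hker] at h2
  rw [← e.finrank_eq]
  omega

/-- The **Hilbert–Serre theorem**, by induction on a set `S` of homogeneous elements of positive
degree such that `R` is spanned by `1` modulo `S` and the annihilator of `M`. An element of `S` can
be dropped for the kernel and the cokernel of its action on `M`, which it annihilates. -/
theorem hilbertSeries_mem_range [IsNoetherianRing R] [GradedAlgebra 𝒜] (h𝒜 : 𝒜 0 = 1)
    [Algebra.FiniteType k R] (S : Finset R) (hS : ∀ x ∈ S, ∃ d : ℕ, d ≠ 0 ∧ x ∈ 𝒜 d) :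
    ∀ {M : Type v} [AddCommGroup M] [Module k M] [Module R M] [IsScalarTower k R M]
      [Module.Finite R M] {ℳ : ℤ → Submodule k M} (_ : IsGradedModule 𝒜 ℳ)
      (_ : ∀ r : R, ∃ c : k, r - algebraMap k R c ∈
        Ideal.span (S : Set R) ⊔ Module.annihilator R M)
      {H : LaurentSeries ℚ} (_ : IsHilbertSeries ℳ H),
      ∃ f : RatFunc ℚ, (f : LaurentSeries ℚ) = H := by
  classical
  induction S using Finset.induction_on with
  | empty =>
    intro M _ _ _ _ _ ℳ h hann H hH
    -- Now `R` acts through `k`, so `M` is finite dimensional and `H` is a Laurent polynomial.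
    have hM : Module.Finite k M := by
      obtain ⟨T, hT⟩ := Module.Finite.fg_top (R := R) (M := M)
      refine ⟨T, eq_top_iff.2 fun m _ => ?_⟩
      have hm : m ∈ Submodule.span R (T : Set M) := by rw [hT]; trivial
      induction hm using Submodule.span_induction with
      | mem x hx => exact Submodule.subset_span hx
      | zero => exact zero_mem _
      | add x y _ _ hx hy => exact add_mem (hx trivial) (hy trivial)
      | smul r x _ hx =>
        obtain ⟨c, hc⟩ := hann r
        rw [Finset.coe_empty, Ideal.span_empty, bot_sup_eq, Module.mem_annihilator] at hc
        have := hc x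
        rw [sub_smul, algebraMap_smul, sub_eq_zero] at this
        rw [this]
        exact Submodule.smul_mem _ c (hx trivial)
    have hfin : {j | ℳ j ≠ ⊥}.Finite :=
      WellFoundedGT.finite_ne_bot_of_iSupIndep h.isInternal.submodule_iSupIndep
    refine ⟨∑ j ∈ hfin.toFinset, Module.finrank k (ℳ j) • RatFunc.X ^ j, ?_⟩
    ext i
    have hterm : ∀ j, (Module.finrank k (ℳ j) •
        ((RatFunc.X ^ j : RatFunc ℚ) : LaurentSeries ℚ)).coeff i =
          if i = j then (Module.finrank k (ℳ j) : ℚ) else 0 := by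
      intro j
      rw [coe_ratFunc_X_zpow, HahnSeries.coeff_smul, HahnSeries.coeff_single]
      split_ifs <;> simp
    rw [map_sum, HahnSeries.coeff_sum,
      Finset.sum_congr rfl fun j _ => (congrArg (fun H => HahnSeries.coeff H i)
        (map_nsmul _ _ _)).trans (hterm j), Finset.sum_ite_eq, hH i]
    split_ifs with hi
    · rfl
    · have : ℳ i = ⊥ := by simpa using hi
      rw [this, finrank_bot, Nat.cast_zero]
  | insert x S hxS ih =>
    intro M _ _ _ _ _ ℳ h hann H hH
    obtain ⟨d, hd, hxd⟩ := hS x (Finset.mem_insert_self x S)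
    have hfd := h.finiteDimensional h𝒜
    have hgrK := isGradedModule_subGrading h _ (h.component_mem_ker_lsmul hxd)
    have hgrC := isGradedModule_quotGrading h _ (h.component_mem_range_lsmul hxd)
    obtain ⟨bK, hbK⟩ := hgrK.exists_eq_bot_of_lt h𝒜
    obtain ⟨bC, hbC⟩ := hgrC.exists_eq_bot_of_lt h𝒜
    obtain ⟨HK, hHK⟩ := exists_isHilbertSeries hbK
    obtain ⟨HC, hHC⟩ := exists_isHilbertSeries hbC
    have hS' : ∀ y ∈ S, ∃ d : ℕ, d ≠ 0 ∧ y ∈ 𝒜 d := fun y hy => hS y (Finset.mem_insert_of_mem hy)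
    have hann' : ∀ J : Ideal R, x ∈ J → Module.annihilator R M ≤ J → ∀ r : R, ∃ c : k,
        r - algebraMap k R c ∈ Ideal.span (S : Set R) ⊔ J := by
      intro J hxJ hJ r
      obtain ⟨c, hc⟩ := hann r
      refine ⟨c, ?_⟩
      have hle : Ideal.span ((insert x S : Finset R) : Set R) ⊔ Module.annihilator R M ≤
          Ideal.span (S : Set R) ⊔ J := by
        refine sup_le (Ideal.span_le.2 ?_) (hJ.trans le_sup_right)
        intro y hy
        rw [Finset.coe_insert] at hy
        rcases hy with rfl | hy
        · exact Ideal.mem_sup_right hxJ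
        · exact Ideal.mem_sup_left (Ideal.subset_span hy)
      exact hle hc
    obtain ⟨fK, hfK⟩ := ih hS' hgrK (hann' _
      (Module.mem_annihilator.2 fun m => Subtype.ext m.2)
      (LinearMap.annihilator_le_of_injective _ (Submodule.subtype_injective _))) hHK
    obtain ⟨fC, hfC⟩ := ih hS' hgrC (hann' _
      (Module.mem_annihilator.2 fun m => by
        obtain ⟨m, rfl⟩ := Submodule.mkQ_surjective _ m
        exact (Submodule.Quotient.mk_eq_zero _).2 ⟨m, rfl⟩)
      (LinearMap.annihilator_le_of_surjective _ (Submodule.mkQ_surjective _))) hHC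
    have hrec : H - HC = ((RatFunc.X ^ (d : ℤ) : RatFunc ℚ) : LaurentSeries ℚ) * (H - HK) := by
      ext j
      rw [coe_ratFunc_X_zpow_mul_coeff, HahnSeries.coeff_sub, HahnSeries.coeff_sub, hH, hH, hHC,
        hHK]
      have := h.finrank_add_finrank_ker_lsmul hxd j
      have : (_ : ℚ) = _ := congrArg (Nat.cast (R := ℚ)) this
      push_cast at this
      linarith
    have h0 : (1 - RatFunc.X ^ d : RatFunc ℚ) ≠ 0 := one_sub_X_pow_ne_zero hd
    have h0' : ((1 - RatFunc.X ^ d : RatFunc ℚ) : LaurentSeries ℚ) ≠ 0 :=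
      (map_ne_zero _).2 h0
    refine ⟨(fC - RatFunc.X ^ d * fK) / (1 - RatFunc.X ^ d), ?_⟩
    rw [map_div₀, div_eq_iff h0', map_sub, map_mul, hfC, hfK, map_sub, map_one]
    rw [zpow_natCast] at hrec
    linear_combination -hrec

/-- The Hilbert series of a finitely generated graded module has a pole at `1` whose order is the
dimension of the module, with a positive leading coefficient. -/
theorem exists_hilbertSeries_eq [GradedAlgebra 𝒜] (h𝒜 : 𝒜 0 = 1)
    [Algebra.FiniteType k R] [Nontrivial M] [Module.Finite R M] (h : IsGradedModule 𝒜 ℳ) :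
    ∃ (s : ℕ) (e : RatFunc ℚ), Module.supportDim R M = s ∧ PosAtOne e ∧
      ∀ H, IsHilbertSeries ℳ H →
        H = ((e / (1 - RatFunc.X) ^ s : RatFunc ℚ) : LaurentSeries ℚ) := by
  have : IsNoetherianRing R := Algebra.FiniteType.isNoetherianRing k R
  obtain ⟨hfd, s, hs, b, hb, C, D, c, hD, hupper, hlower⟩ := h.exists_growth h𝒜
  obtain ⟨S, hS, hS'⟩ := exists_homogeneous_algebra_generators 𝒜 h𝒜
  have hres : ∀ r : R, ∃ c : k, r - algebraMap k R c ∈ Ideal.span (S : Set R) ⊔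
      Module.annihilator R M := by
    intro r
    have hr : r ∈ Algebra.adjoin k (S : Set R) := by rw [hS]; trivial
    suffices ∃ c : k, r - algebraMap k R c ∈ Ideal.span (S : Set R) from
      this.imp fun c hc => Ideal.mem_sup_left hc
    induction hr using Algebra.adjoin_induction with
    | mem x hx => exact ⟨0, by simpa using Ideal.subset_span hx⟩
    | algebraMap c => exact ⟨c, by simp⟩
    | add x y _ _ hx hy =>
      obtain ⟨a, ha⟩ := hx
      obtain ⟨b, hb⟩ := hy
      refine ⟨a + b, ?_⟩
      rw [map_add, add_sub_add_comm]
      exact add_mem ha hb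
    | mul x y _ _ hx hy =>
      obtain ⟨a, ha⟩ := hx
      obtain ⟨b, hb⟩ := hy
      refine ⟨a * b, ?_⟩
      have : x * y - algebraMap k R (a * b) =
          y * (x - algebraMap k R a) + algebraMap k R a * (y - algebraMap k R b) := by
        rw [map_mul]; ring
      rw [this]
      exact add_mem (Ideal.mul_mem_left _ _ ha) (Ideal.mul_mem_left _ _ hb)
  obtain ⟨H, hH⟩ := exists_isHilbertSeries hb
  obtain ⟨f, hf⟩ := hilbertSeries_mem_range h𝒜 S hS' h hres hH
  let a : ℕ → ℕ := fun n => ∑ i ∈ Finset.range (n + 1), Module.finrank k (ℳ (b + i))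
  -- The generating function of the partial sums of the Hilbert function, starting in degree `b`.
  let g : RatFunc ℚ := RatFunc.X ^ (-b) * f / (1 - RatFunc.X)
  have hX : (1 - RatFunc.X : RatFunc ℚ) ≠ 0 := one_sub_X_ne_zero
  have hXL : ((1 - RatFunc.X : RatFunc ℚ) : LaurentSeries ℚ) ≠ 0 := (map_ne_zero _).2 hX
  have hag : ((PowerSeries.mk fun n => (a n : ℚ) : PowerSeries ℚ) : LaurentSeries ℚ) = g := by
    have h1 : (PowerSeries.mk fun n => (a n : ℚ)) * (1 - PowerSeries.X) =
        PowerSeries.mk fun n => (Module.finrank k (ℳ (b + n)) : ℚ) := by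
      ext n
      rw [mul_sub, mul_one, map_sub]
      cases n with
      | zero => simp [a]
      | succ n =>
        rw [PowerSeries.coeff_succ_mul_X, PowerSeries.coeff_mk, PowerSeries.coeff_mk,
          PowerSeries.coeff_mk]
        simp only [a]
        rw [Finset.sum_range_succ _ (n + 1), Nat.cast_add, add_sub_cancel_left]
    have h2 : ((PowerSeries.mk fun n => (Module.finrank k (ℳ (b + n)) : ℚ) : PowerSeries ℚ) :
        LaurentSeries ℚ) = ((RatFunc.X ^ (-b) : RatFunc ℚ) : LaurentSeries ℚ) * H := by
      ext j
      rw [coe_ratFunc_X_zpow_mul_coeff, PowerSeries.coeff_coe, hH]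
      split_ifs with hj
      · rw [hb _ (by omega)]; simp
      · rw [PowerSeries.coeff_mk]
        have hidx : b + (j.natAbs : ℤ) = j - -b := by omega
        rw [hidx]
    rw [map_div₀, map_mul, hf, ← h2, eq_div_iff hXL, ← h1, PowerSeries.coe_mul, PowerSeries.coe_sub,
      PowerSeries.coe_one, PowerSeries.coe_X, map_sub, map_one, RatFunc.coe_X]
  have hpq : PowerSeries.mk (fun n => (a n : ℚ)) * (g.denom : PowerSeries ℚ) = g.num := by
    apply HahnSeries.ofPowerSeries_injective (Γ := ℤ)
    rw [map_mul]
    have h1 : ((g.denom : PowerSeries ℚ) : LaurentSeries ℚ) ≠ 0 := by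
      rw [RatFunc.coe_coe]
      exact (map_ne_zero _).2 (RatFunc.algebraMap_ne_zero g.denom_ne_zero)
    have h2 : (g : LaurentSeries ℚ) = ((g.num : PowerSeries ℚ) : LaurentSeries ℚ) /
        ((g.denom : PowerSeries ℚ) : LaurentSeries ℚ) := by
      rw [RatFunc.coe_coe, RatFunc.coe_coe, ← map_div₀]
      exact congrArg _ g.num_div_denom.symm
    exact (congrArg (· * ((g.denom : PowerSeries ℚ) : LaurentSeries ℚ)) (hag.trans h2)).trans
      (div_mul_cancel₀ _ h1)
  obtain ⟨u, v, hu, hv, huv⟩ :=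
    exists_pos_eval_one_of_growth g.denom_ne_zero hpq hupper hD hlower
  have hv0 : algebraMap (Polynomial ℚ) (RatFunc ℚ) v ≠ 0 :=
    RatFunc.algebraMap_ne_zero fun h => by simp [h] at hv
  refine ⟨s, algebraMap (Polynomial ℚ) (RatFunc ℚ) u / algebraMap (Polynomial ℚ) (RatFunc ℚ) v *
    RatFunc.X ^ b, hs, PosAtOne.mul ⟨u, v, hu, hv, rfl⟩ (PosAtOne.X_zpow b), fun H' hH' => ?_⟩
  have hHH' : H' = H := by ext j; rw [hH', hH]
  rw [hHH', ← hf]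
  congr 1
  have hden : algebraMap (Polynomial ℚ) (RatFunc ℚ) g.denom ≠ 0 :=
    RatFunc.algebraMap_ne_zero g.denom_ne_zero
  have h1 : algebraMap (Polynomial ℚ) (RatFunc ℚ) u =
      algebraMap (Polynomial ℚ) (RatFunc ℚ) v * (g * (1 - RatFunc.X) ^ (s + 1)) := by
    have := congrArg (algebraMap (Polynomial ℚ) (RatFunc ℚ)) huv
    simp only [map_mul, map_pow, map_sub, map_one, RatFunc.algebraMap_X] at this
    have hg := (div_eq_iff hden).1 g.num_div_denom
    rw [hg] at this
    refine mul_right_cancel₀ hden (this.trans ?_)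
    ring
  have hXb : (RatFunc.X : RatFunc ℚ) ^ b ≠ 0 := zpow_ne_zero _ RatFunc.X_ne_zero
  rw [h1]
  simp only [g]
  rw [zpow_neg]
  field_simp
  ring

end IsGradedModule

end HilbertSerre

/-! ### Linear algebra of short exact sequences of complexes -/

section LinearAlgebra

variable {k : Type*} [Field k]

theorem nonempty_range_equiv_of_ker_eq {W A B : Type*} [AddCommGroup W] [Module k W]
    [AddCommGroup A] [Module k A] [AddCommGroup B] [Module k B] {f : W →ₗ[k] A} {g : W →ₗ[k] B}
    (h : LinearMap.ker f = LinearMap.ker g) :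
    Nonempty (LinearMap.range f ≃ₗ[k] LinearMap.range g) :=
  ⟨f.quotKerEquivRange.symm ≪≫ₗ Submodule.quotEquivOfEq _ _ h ≪≫ₗ g.quotKerEquivRange⟩

variable {A₁ A₀ B₂ B₁ B₀ C₂ C₁ C₀ : Type*}
  [AddCommGroup A₁] [Module k A₁] [AddCommGroup A₀] [Module k A₀]
  [AddCommGroup B₂] [Module k B₂] [AddCommGroup B₁] [Module k B₁] [AddCommGroup B₀] [Module k B₀]
  [AddCommGroup C₂] [Module k C₂] [AddCommGroup C₁] [Module k C₁] [AddCommGroup C₀] [Module k C₀]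
  {a₁ : A₁ →ₗ[k] A₀} {b₂ : B₂ →ₗ[k] B₁} {b₁ : B₁ →ₗ[k] B₀} {c₂ : C₂ →ₗ[k] C₁} {c₁ : C₁ →ₗ[k] C₀}
  {α₁ : A₁ →ₗ[k] B₁} {α₀ : A₀ →ₗ[k] B₀}
  {β₂ : B₂ →ₗ[k] C₂} {β₁ : B₁ →ₗ[k] C₁} {β₀ : B₀ →ₗ[k] C₀}

/-- The dimension shift: in a short exact sequence of complexes whose middle term `B` is exact in
positive degrees, `H₁(C)` is the kernel of `coker a₁ → coker b₁`. Both spaces are quotients, by the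
same subspace, of the space of pairs `(b, a)` with `b₁ b = α₀ a`. -/
theorem nonempty_homology_equiv_ker (hα₀ : Function.Injective α₀)
    (hαβ₁ : Function.Exact α₁ β₁) (hαβ₀ : Function.Exact α₀ β₀)
    (hβ₂ : Function.Surjective β₂) (hβ₁ : Function.Surjective β₁)
    (ha : α₀ ∘ₗ a₁ = b₁ ∘ₗ α₁) (hb₁ : β₀ ∘ₗ b₁ = c₁ ∘ₗ β₁) (hb₂ : β₁ ∘ₗ b₂ = c₂ ∘ₗ β₂)
    (hB : Function.Exact b₂ b₁)
    (h : LinearMap.range a₁ ≤ (LinearMap.range b₁).comap α₀) :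
    Nonempty ((LinearMap.ker c₁).map (LinearMap.range c₂).mkQ ≃ₗ[k]
      LinearMap.ker ((LinearMap.range a₁).mapQ (LinearMap.range b₁) α₀ h)) := by
  have ha' : ∀ x, α₀ (a₁ x) = b₁ (α₁ x) := fun x => LinearMap.congr_fun ha x
  have hb₁' : ∀ x, β₀ (b₁ x) = c₁ (β₁ x) := fun x => LinearMap.congr_fun hb₁ x
  have hb₂' : ∀ x, β₁ (b₂ x) = c₂ (β₂ x) := fun x => LinearMap.congr_fun hb₂ x
  let W : Submodule k (B₁ × A₀) :=
    LinearMap.eqLocus (b₁ ∘ₗ LinearMap.fst k B₁ A₀) (α₀ ∘ₗ LinearMap.snd k B₁ A₀)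
  have hW : ∀ p : W, b₁ p.1.1 = α₀ p.1.2 := fun p => p.2
  let f : W →ₗ[k] C₁ ⧸ LinearMap.range c₂ :=
    (LinearMap.range c₂).mkQ ∘ₗ β₁ ∘ₗ LinearMap.fst k B₁ A₀ ∘ₗ W.subtype
  let g : W →ₗ[k] A₀ ⧸ LinearMap.range a₁ :=
    (LinearMap.range a₁).mkQ ∘ₗ LinearMap.snd k B₁ A₀ ∘ₗ W.subtype
  have hf : LinearMap.range f = (LinearMap.ker c₁).map (LinearMap.range c₂).mkQ := by
    apply le_antisymm
    · rintro _ ⟨p, rfl⟩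
      refine ⟨β₁ p.1.1, ?_, rfl⟩
      change c₁ (β₁ p.1.1) = 0
      rw [← hb₁', hW, hαβ₀.apply_apply_eq_zero]
    · rintro _ ⟨c, hc, rfl⟩
      obtain ⟨b, rfl⟩ := hβ₁ c
      obtain ⟨a, ha⟩ := (hαβ₀ (b₁ b)).1 ((hb₁' b).trans hc)
      exact ⟨⟨(b, a), ha.symm⟩, rfl⟩
  have hg : LinearMap.range g =
      LinearMap.ker ((LinearMap.range a₁).mapQ (LinearMap.range b₁) α₀ h) := by
    apply le_antisymm
    · rintro _ ⟨p, rfl⟩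
      exact (Submodule.Quotient.mk_eq_zero _).2 ⟨p.1.1, hW p⟩
    · intro y hy
      obtain ⟨a, rfl⟩ := Submodule.mkQ_surjective _ y
      obtain ⟨b, hb⟩ := (Submodule.Quotient.mk_eq_zero _).1 hy
      exact ⟨⟨(b, a), hb⟩, rfl⟩
  have hker : LinearMap.ker f = LinearMap.ker g := by
    ext p
    have h1 : p ∈ LinearMap.ker f ↔ ∃ c, c₂ c = β₁ p.1.1 := Submodule.Quotient.mk_eq_zero _
    have h2 : p ∈ LinearMap.ker g ↔ ∃ a, a₁ a = p.1.2 := Submodule.Quotient.mk_eq_zero _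
    rw [h1, h2]
    constructor
    · rintro ⟨c, hc⟩
      obtain ⟨b, rfl⟩ := hβ₂ c
      rw [← hb₂'] at hc
      obtain ⟨a, ha⟩ := (hαβ₁ (p.1.1 - b₂ b)).1 (by rw [map_sub, hc, sub_self])
      refine ⟨a, hα₀ ?_⟩
      rw [ha', ha, map_sub, hB.apply_apply_eq_zero, sub_zero, hW]
    · rintro ⟨a, ha⟩
      obtain ⟨b, hb⟩ := (hB (p.1.1 - α₁ a)).1 (by rw [map_sub, ← ha', ha, hW, sub_self])
      refine ⟨β₂ b, ?_⟩
      rw [← hb₂', hb, map_sub, hαβ₁.apply_apply_eq_zero, sub_zero]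
  obtain ⟨e⟩ := nonempty_range_equiv_of_ker_eq hker
  exact ⟨LinearEquiv.ofEq _ _ hf.symm ≪≫ₗ e ≪≫ₗ LinearEquiv.ofEq _ _ hg⟩

/-- If `B` is exact, the kernel of `coker a₁ → coker b₁` is the homology of `A`. -/
theorem ker_mapQ_eq_map_ker {A' B' : Type*} [AddCommGroup A'] [Module k A']
    [AddCommGroup B'] [Module k B'] {a₀ : A₀ →ₗ[k] A'} {b₀ : B₀ →ₗ[k] B'} {α' : A' →ₗ[k] B'}
    (hα' : Function.Injective α') (ha : α' ∘ₗ a₀ = b₀ ∘ₗ α₀) (hB : Function.Exact b₁ b₀)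
    (h : LinearMap.range a₁ ≤ (LinearMap.range b₁).comap α₀) :
    LinearMap.ker ((LinearMap.range a₁).mapQ (LinearMap.range b₁) α₀ h) =
      (LinearMap.ker a₀).map (LinearMap.range a₁).mkQ := by
  have ha' : ∀ x, α' (a₀ x) = b₀ (α₀ x) := fun x => LinearMap.congr_fun ha x
  have key : ∀ a, a ∈ LinearMap.ker a₀ ↔ α₀ a ∈ LinearMap.range b₁ := by
    intro a
    rw [LinearMap.mem_ker, ← map_eq_zero_iff α' hα', ha']
    exact hB _
  apply le_antisymm
  · intro y hy
    obtain ⟨a, rfl⟩ := Submodule.mkQ_surjective _ y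
    exact ⟨a, (key a).2 ((Submodule.Quotient.mk_eq_zero _).1 hy), rfl⟩
  · rintro _ ⟨a, ha, rfl⟩
    exact (Submodule.Quotient.mk_eq_zero _).2 ((key a).1 ha)

/-- The dimension count for `0 → ker → coker a₁ → coker b₁ → coker c₁ → 0`. -/
theorem finrank_coker_sequence (hαβ₀ : Function.Exact α₀ β₀) (hβ₁ : Function.Surjective β₁)
    (hβ₀ : Function.Surjective β₀) (hb₁ : β₀ ∘ₗ b₁ = c₁ ∘ₗ β₁)
    (h : LinearMap.range a₁ ≤ (LinearMap.range b₁).comap α₀)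
    [FiniteDimensional k (B₀ ⧸ LinearMap.range b₁)] :
    FiniteDimensional k (C₀ ⧸ LinearMap.range c₁) ∧
    Module.finrank k (C₀ ⧸ LinearMap.range c₁) ≤ Module.finrank k (B₀ ⧸ LinearMap.range b₁) ∧
    (FiniteDimensional k (A₀ ⧸ LinearMap.range a₁) →
      Module.finrank k (LinearMap.ker ((LinearMap.range a₁).mapQ (LinearMap.range b₁) α₀ h)) +
          Module.finrank k (B₀ ⧸ LinearMap.range b₁) =
        Module.finrank k (A₀ ⧸ LinearMap.range a₁) +
          Module.finrank k (C₀ ⧸ LinearMap.range c₁)) := by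
  have hb₁' : ∀ x, β₀ (b₁ x) = c₁ (β₁ x) := fun x => LinearMap.congr_fun hb₁ x
  have h' : LinearMap.range b₁ ≤ (LinearMap.range c₁).comap β₀ := by
    rintro _ ⟨b, rfl⟩
    exact ⟨β₁ b, (hb₁' b).symm⟩
  let φ := (LinearMap.range a₁).mapQ (LinearMap.range b₁) α₀ h
  let ψ := (LinearMap.range b₁).mapQ (LinearMap.range c₁) β₀ h'
  have hψ : Function.Surjective ψ := by
    intro y
    obtain ⟨c, rfl⟩ := Submodule.mkQ_surjective _ y
    obtain ⟨b, rfl⟩ := hβ₀ c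
    exact ⟨(LinearMap.range b₁).mkQ b, rfl⟩
  have hφψ : LinearMap.ker ψ = LinearMap.range φ := by
    apply le_antisymm
    · intro y hy
      obtain ⟨b, rfl⟩ := Submodule.mkQ_surjective _ y
      obtain ⟨c, hc⟩ := (Submodule.Quotient.mk_eq_zero _).1 hy
      obtain ⟨b', rfl⟩ := hβ₁ c
      obtain ⟨a, ha⟩ := (hαβ₀ (b - b₁ b')).1 (by rw [map_sub, hb₁', hc, sub_self])
      refine ⟨(LinearMap.range a₁).mkQ a, ?_⟩
      refine (congrArg (LinearMap.range b₁).mkQ ha).trans ?_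
      rw [map_sub, sub_eq_self]
      exact (Submodule.Quotient.mk_eq_zero _).2 ⟨b', rfl⟩
    · rintro _ ⟨y, rfl⟩
      obtain ⟨a, rfl⟩ := Submodule.mkQ_surjective _ y
      refine (Submodule.Quotient.mk_eq_zero _).2 ?_
      rw [hαβ₀.apply_apply_eq_zero]
      exact zero_mem _
  refine ⟨Module.Finite.of_surjective ψ hψ, LinearMap.finrank_le_finrank_of_surjective hψ,
    fun _ => ?_⟩
  have h1 := φ.finrank_range_add_finrank_ker
  have h2 := ψ.finrank_range_add_finrank_ker
  rw [hφψ, LinearMap.range_eq_top.2 hψ, finrank_top] at h2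
  change Module.finrank k (LinearMap.ker φ) + _ = _
  omega

end LinearAlgebra

/-! ### The grading of a tensor product with a free module -/

section TensorGrading

variable {k R X Y M N P : Type*} [Field k] [CommRing R] [Algebra k R]
  [AddCommGroup X] [Module k X] [Module R X] [IsScalarTower k R X]
  [AddCommGroup Y] [Module k Y] [Module R Y] [IsScalarTower k R Y]
  [AddCommGroup N] [Module k N] [Module R N] [IsScalarTower k R N]
  [AddCommGroup P] [Module k P] [Module R P] [IsScalarTower k R P]
  {𝒜 : ℕ → Submodule k R} {𝒳 : ℤ → Submodule k X} {𝒴 : ℤ → Submodule k Y}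
  {𝒩 : ℤ → Submodule k N} {𝒬 : ℤ → Submodule k P}

omit [IsScalarTower k R N] in
theorem tmul_mem_tensorGrading {a b j : ℤ} {x : X} {n : N} (hx : x ∈ 𝒳 a) (hn : n ∈ 𝒩 b)
    (h : a + b = j) : x ⊗ₜ[R] n ∈ tensorGrading R 𝒳 𝒩 j :=
  Submodule.subset_span ⟨a, b, x, n, hx, hn, h, rfl⟩

omit [IsScalarTower k R N] in
theorem rTensor_mem_tensorGrading (φ : X →ₗ[R] Y) (hφ : ∀ j, ∀ x ∈ 𝒳 j, φ x ∈ 𝒴 j) (j : ℤ) :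
    ∀ x ∈ tensorGrading R 𝒳 𝒩 j, φ.rTensor N x ∈ tensorGrading R 𝒴 𝒩 j := by
  intro x hx
  have : tensorGrading R 𝒳 𝒩 j ≤
      (tensorGrading R 𝒴 𝒩 j).comap ((φ.rTensor N).restrictScalars k) := by
    refine Submodule.span_le.2 ?_
    rintro _ ⟨a, b, x, n, hx, hn, h, rfl⟩
    exact tmul_mem_tensorGrading (hφ a x hx) hn h
  exact this hx

omit [IsScalarTower k R N] [IsScalarTower k R P] in
theorem lTensor_mem_tensorGrading (φ : N →ₗ[R] P) (hφ : ∀ j, ∀ x ∈ 𝒩 j, φ x ∈ 𝒬 j) (j : ℤ) :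
    ∀ x ∈ tensorGrading R 𝒳 𝒩 j, φ.lTensor X x ∈ tensorGrading R 𝒳 𝒬 j := by
  intro x hx
  have : tensorGrading R 𝒳 𝒩 j ≤
      (tensorGrading R 𝒳 𝒬 j).comap ((φ.lTensor X).restrictScalars k) := by
    refine Submodule.span_le.2 ?_
    rintro _ ⟨a, b, x, n, hx, hn, h, rfl⟩
    exact tmul_mem_tensorGrading hx (hφ b n hn) h
  exact this hx

omit [IsScalarTower k R N] in
theorem intGrading_smul_mem (h : IsGradedModule 𝒜 𝒩) {i j : ℤ} {r : R} (hr : r ∈ intGrading 𝒜 i)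
    {n : N} (hn : n ∈ 𝒩 j) : r • n ∈ 𝒩 (i + j) := by
  rcases lt_or_ge i 0 with hneg | hnn
  · rw [intGrading_of_neg 𝒜 hneg] at hr
    rw [(Submodule.mem_bot k).1 hr, zero_smul]
    exact zero_mem _
  · lift i to ℕ using hnn
    rw [intGrading_natCast] at hr
    exact h.smul_mem hr hn

/-- The coordinates of a homogeneous element in a homogeneous basis are homogeneous. -/
theorem repr_mem_intGrading [GradedAlgebra 𝒜] (h : IsGradedModule 𝒜 𝒳)
    {ι : Type*} (b : Module.Basis ι R X) {deg : ι → ℤ} (hb : ∀ s, b s ∈ 𝒳 (deg s)) {j : ℤ} {x : X}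
    (hx : x ∈ 𝒳 j) : ∀ s, b.repr x s ∈ intGrading 𝒜 (j - deg s) := by
  have hfree := isGradedModule_finsuppGrading (isGradedModule_intGrading 𝒜) deg
  let φ : (ι →₀ R) →ₗ[k] X := (b.repr.symm : (ι →₀ R) →ₗ[R] X).restrictScalars k
  have hφ : ∀ i, ∀ f ∈ finsuppGrading (intGrading 𝒜) deg i, φ f ∈ 𝒳 i := by
    intro i f hf
    change b.repr.symm f ∈ 𝒳 i
    rw [b.repr_symm_apply, Finsupp.linearCombination_apply]
    refine sum_mem fun s _ => ?_
    have := intGrading_smul_mem h (hf s) (hb s)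
    rwa [sub_add_cancel] at this
  obtain ⟨f, hf, rfl⟩ := hfree.isInternal.exists_mem_of_mem_range h.isInternal φ hφ hx
    ⟨b.repr x, b.repr.symm_apply_apply x⟩
  intro s
  change b.repr (b.repr.symm f) s ∈ _
  rw [LinearEquiv.apply_symm_apply]
  exact hf s

/-- In terms of a homogeneous basis of `X`, the grading of `X ⊗ N` is the grading of a direct sum of
shifted copies of `N`. In particular it is a grading. -/
theorem mem_tensorGrading_iff [GradedAlgebra 𝒜] (h : IsGradedModule 𝒜 𝒳)
    (h' : IsGradedModule 𝒜 𝒩) {ι : Type*} [DecidableEq ι] (b : Module.Basis ι R X) {deg : ι → ℤ}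
    (hb : ∀ s, b s ∈ 𝒳 (deg s)) {j : ℤ} (x : X ⊗[R] N) :
    x ∈ tensorGrading R 𝒳 𝒩 j ↔
      TensorProduct.equivFinsuppOfBasisLeft b x ∈ finsuppGrading 𝒩 deg j := by
  constructor
  · intro hx
    have : tensorGrading R 𝒳 𝒩 j ≤ (finsuppGrading 𝒩 deg j).comap
        ((TensorProduct.equivFinsuppOfBasisLeft (N := N) b).toLinearMap.restrictScalars k) := by
      refine Submodule.span_le.2 ?_
      rintro _ ⟨a, c, y, n, hy, hn, rfl, rfl⟩ s
      change TensorProduct.equivFinsuppOfBasisLeft b (y ⊗ₜ[R] n) s ∈ _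
      rw [TensorProduct.equivFinsuppOfBasisLeft_apply_tmul_apply]
      have := intGrading_smul_mem h' (repr_mem_intGrading h b hb hy s) hn
      convert this using 2
      ring
    exact this hx
  · intro hx
    obtain ⟨f, rfl⟩ := (TensorProduct.equivFinsuppOfBasisLeft b).symm.surjective x
    rw [LinearEquiv.apply_symm_apply] at hx
    rw [TensorProduct.equivFinsuppOfBasisLeft_symm_apply]
    exact sum_mem fun s _ => tmul_mem_tensorGrading (hb s) (hx s) (by ring)

theorem isInternal_tensorGrading [GradedAlgebra 𝒜] (h : IsGradedModule 𝒜 𝒳)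
    (h' : IsGradedModule 𝒜 𝒩) {ι : Type*} (b : Module.Basis ι R X) {deg : ι → ℤ}
    (hb : ∀ s, b s ∈ 𝒳 (deg s)) : DirectSum.IsInternal (tensorGrading R 𝒳 𝒩) := by
  classical
  have hfree := (isGradedModule_finsuppGrading h' deg).isInternal
  let e : (X ⊗[R] N) ≃ₗ[k] (ι →₀ N) :=
    (TensorProduct.equivFinsuppOfBasisLeft b : (X ⊗[R] N) ≃ₗ[R] (ι →₀ N)).restrictScalars k
  have he : ∀ j x, x ∈ tensorGrading R 𝒳 𝒩 j ↔ e x ∈ finsuppGrading 𝒩 deg j :=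
    fun j x => mem_tensorGrading_iff h h' b hb x
  refine isInternal_of_components
    (fun j => e.symm.toLinearMap ∘ₗ hfree.component j ∘ₗ e.toLinearMap) ?_ ?_ fun x => ?_
  · intro j x hx
    simp [hfree.component_of_mem ((he j x).1 hx)]
  · intro i j hij x hx
    simp [hfree.component_of_mem_ne hij ((he i x).1 hx)]
  · obtain ⟨s, hs, -⟩ := hfree.exists_sum_component (e x)
    rw [← e.symm_apply_apply x, ← hs, map_sum]
    refine sum_mem fun j _ => Submodule.mem_iSup_of_mem j ?_
    rw [he, LinearEquiv.apply_symm_apply]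
    exact hfree.component_mem j _

end TensorGrading

/-! ### Homogeneous pieces of the complex computing Tor -/

namespace GradedFreeResolution

variable {k R M N P G : Type*} [Field k] [CommRing R] [Algebra k R]
  [AddCommGroup M] [Module k M] [Module R M]
  [AddCommGroup N] [Module k N] [Module R N] [IsScalarTower k R N]
  [AddCommGroup P] [Module k P] [Module R P] [IsScalarTower k R P]
  [AddCommGroup G] [Module k G] [Module R G] [IsScalarTower k R G]
  {𝒜 : ℕ → Submodule k R} {ℳ : ℤ → Submodule k M}
  (F : GradedFreeResolution.{w} 𝒜 ℳ) (𝒩 : ℤ → Submodule k N) (𝒬 : ℤ → Submodule k P)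
  (𝒢 : ℤ → Submodule k G) (j : ℤ)

/-- The component of degree `j` of `Xᵢ ⊗ N`. -/
abbrev Piece (i : ℕ) : Type _ := ↥(tensorGrading R (F.grading i) 𝒩 j)

/-- The component of degree `j` of the differential of `X ⊗ N`. -/
def pieceD (i : ℕ) : F.Piece 𝒩 j (i + 1) →ₗ[k] F.Piece 𝒩 j i :=
  (((F.d i).rTensor N).restrictScalars k).restrict
    (rTensor_mem_tensorGrading (F.d i) (F.d_mem i) j)

/-- The cokernel of the component of degree `j` of the differential of `X ⊗ N`. -/
abbrev PieceCoker (i : ℕ) : Type _ := F.Piece 𝒩 j i ⧸ LinearMap.range (F.pieceD 𝒩 j i)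

/-- The homology of the component of degree `j` of `X ⊗ N`, as a subspace of the cokernel of the
differential. -/
def pieceHomology : ∀ i : ℕ, Submodule k (F.PieceCoker 𝒩 j i)
  | 0 => ⊤
  | i + 1 => (LinearMap.ker (F.pieceD 𝒩 j i)).map (LinearMap.range (F.pieceD 𝒩 j (i + 1))).mkQ

variable {𝒩 𝒬 𝒢}

instance free_X (i : ℕ) : Module.Free R (F.X i) := by
  obtain ⟨ι, b, -⟩ := F.exists_homogeneous_basis i
  exact Module.Free.of_basis b

theorem isInternal_tensorGrading [GradedAlgebra 𝒜] (h : IsGradedModule 𝒜 𝒩) (i : ℕ) :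
    DirectSum.IsInternal (tensorGrading R (F.grading i) 𝒩) := by
  obtain ⟨ι, b, hb⟩ := F.exists_homogeneous_basis i
  choose deg hdeg using hb
  exact _root_.isInternal_tensorGrading (F.isGradedModule i) h b hdeg

/-- Taking homogeneous components commutes with homology: a homogeneous cycle is a boundary if and
only if it is the boundary of a homogeneous element. -/
theorem nonempty_torGrading_equiv [GradedAlgebra 𝒜] (h : IsGradedModule 𝒜 𝒩) (i : ℕ) :
    Nonempty (F.torGrading 𝒩 i j ≃ₗ[k] F.pieceHomology 𝒩 j i) := by
  let Z : Submodule k (F.Piece 𝒩 j i) :=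
    ((F.cycles N i).restrictScalars k).comap (tensorGrading R (F.grading i) 𝒩 j).subtype
  let f : Z →ₗ[k] F.Tor N i :=
    ((F.boundaries N i).mkQ.restrictScalars k) ∘ₗ
      (((tensorGrading R (F.grading i) 𝒩 j).subtype ∘ₗ Z.subtype).codRestrict
        ((F.cycles N i).restrictScalars k) fun z => z.2)
  let g : Z →ₗ[k] F.PieceCoker 𝒩 j i := (LinearMap.range (F.pieceD 𝒩 j i)).mkQ ∘ₗ Z.subtype
  have hf : LinearMap.range f = F.torGrading 𝒩 i j := by
    apply le_antisymm
    · rintro _ ⟨z, rfl⟩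
      exact ⟨⟨z.1.1, z.2⟩, z.1.2, rfl⟩
    · rintro _ ⟨z, hz, rfl⟩
      exact ⟨⟨⟨z.1, hz⟩, z.2⟩, rfl⟩
  have hg : LinearMap.range g = F.pieceHomology 𝒩 j i := by
    have h1 : LinearMap.range g = Z.map (LinearMap.range (F.pieceD 𝒩 j i)).mkQ := by
      rw [LinearMap.range_comp, Submodule.range_subtype]
    rw [h1]
    cases i with
    | zero =>
      have : Z = ⊤ := eq_top_iff.2 fun _ _ => trivial
      rw [this, Submodule.map_top, Submodule.range_mkQ]
      rfl
    | succ i =>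
      have : Z = LinearMap.ker (F.pieceD 𝒩 j i) := by
        ext z
        exact ⟨fun hz => Subtype.ext hz, fun hz => congrArg Subtype.val hz⟩
      rw [this]
      rfl
  have hker : LinearMap.ker f = LinearMap.ker g := by
    ext z
    have h1 : z ∈ LinearMap.ker f ↔ ∃ y, (F.d i).rTensor N y = z.1.1 :=
      Submodule.Quotient.mk_eq_zero _
    have h2 : z ∈ LinearMap.ker g ↔ ∃ y, F.pieceD 𝒩 j i y = z.1 := Submodule.Quotient.mk_eq_zero _
    rw [h1, h2]
    constructor
    · intro hy
      obtain ⟨y, hy, hyz⟩ := (F.isInternal_tensorGrading h (i + 1)).exists_mem_of_mem_range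
        (F.isInternal_tensorGrading h i) (((F.d i).rTensor N).restrictScalars k)
        (rTensor_mem_tensorGrading (F.d i) (F.d_mem i)) z.1.2 hy
      exact ⟨⟨y, hy⟩, Subtype.ext hyz⟩
    · rintro ⟨y, hy⟩
      exact ⟨y.1, congrArg Subtype.val hy⟩
  obtain ⟨e⟩ := nonempty_range_equiv_of_ker_eq (k := k) (W := Z) (A := F.Tor N i)
    (B := F.PieceCoker 𝒩 j i) (f := f) (g := g) hker
  exact ⟨LinearEquiv.ofEq _ _ hf.symm ≪≫ₗ e ≪≫ₗ LinearEquiv.ofEq _ _ hg⟩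

theorem nonempty_torGrading_zero_equiv [GradedAlgebra 𝒜] (h : IsGradedModule 𝒜 𝒩) :
    Nonempty (F.torGrading 𝒩 0 j ≃ₗ[k] F.PieceCoker 𝒩 j 0) := by
  obtain ⟨e⟩ := F.nonempty_torGrading_equiv j h 0
  exact ⟨e ≪≫ₗ Submodule.topEquiv⟩

/-- The map induced on pieces of degree `j` by a graded map `N → P`. -/
def pieceMap (φ : N →ₗ[R] P) (hφ : ∀ j, ∀ x ∈ 𝒩 j, φ x ∈ 𝒬 j) (i : ℕ) :
    F.Piece 𝒩 j i →ₗ[k] F.Piece 𝒬 j i :=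
  ((φ.lTensor (F.X i)).restrictScalars k).restrict (lTensor_mem_tensorGrading φ hφ j)

omit [IsScalarTower k R N] [IsScalarTower k R P] in
theorem pieceMap_comp_pieceD (φ : N →ₗ[R] P) (hφ : ∀ j, ∀ x ∈ 𝒩 j, φ x ∈ 𝒬 j) (i : ℕ) :
    F.pieceMap j φ hφ i ∘ₗ F.pieceD 𝒩 j i = F.pieceD 𝒬 j i ∘ₗ F.pieceMap j φ hφ (i + 1) := by
  ext x
  have h1 : φ.lTensor (F.X i) ∘ₗ (F.d i).rTensor N =
      (F.d i).rTensor P ∘ₗ φ.lTensor (F.X (i + 1)) := by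
    rw [LinearMap.lTensor_comp_rTensor, LinearMap.rTensor_comp_lTensor]
  exact LinearMap.congr_fun h1 x.1

omit [IsScalarTower k R N] [IsScalarTower k R P] in
theorem pieceMap_injective (φ : N →ₗ[R] P) (hφ : ∀ j, ∀ x ∈ 𝒩 j, φ x ∈ 𝒬 j)
    (hinj : Function.Injective φ) (i : ℕ) : Function.Injective (F.pieceMap j φ hφ i) :=
  fun _ _ hxy => Subtype.ext
    (Module.Flat.lTensor_preserves_injective_linearMap φ hinj (congrArg Subtype.val hxy))

theorem pieceMap_surjective [GradedAlgebra 𝒜] (h : IsGradedModule 𝒜 𝒩) (h' : IsGradedModule 𝒜 𝒬)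
    (φ : N →ₗ[R] P) (hφ : ∀ j, ∀ x ∈ 𝒩 j, φ x ∈ 𝒬 j)
    (hsurj : Function.Surjective φ) (i : ℕ) : Function.Surjective (F.pieceMap j φ hφ i) := by
  intro y
  obtain ⟨x, hx, hxy⟩ := (F.isInternal_tensorGrading h i).exists_mem_of_mem_range
    (F.isInternal_tensorGrading h' i) ((φ.lTensor (F.X i)).restrictScalars k)
    (lTensor_mem_tensorGrading φ hφ) y.2 (LinearMap.lTensor_surjective _ hsurj y.1)
  exact ⟨⟨x, hx⟩, Subtype.ext hxy⟩

omit [IsScalarTower k R N] in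
theorem pieceMap_exact [GradedAlgebra 𝒜] (h : IsGradedModule 𝒜 𝒬) (h' : IsGradedModule 𝒜 𝒢)
    (α : P →ₗ[R] G) (hα : ∀ j, ∀ x ∈ 𝒬 j, α x ∈ 𝒢 j)
    (π : G →ₗ[R] N) (hπ : ∀ j, ∀ x ∈ 𝒢 j, π x ∈ 𝒩 j)
    (hex : Function.Exact α π) (hsurj : Function.Surjective π) (i : ℕ) :
    Function.Exact (F.pieceMap j α hα i) (F.pieceMap j π hπ i) := by
  have hT := lTensor_exact (F.X i) hex hsurj
  intro y
  constructor
  · intro hy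
    obtain ⟨x, hx, hxy⟩ := (F.isInternal_tensorGrading h i).exists_mem_of_mem_range
      (F.isInternal_tensorGrading h' i) ((α.lTensor (F.X i)).restrictScalars k)
      (lTensor_mem_tensorGrading α hα) y.2 ((hT y.1).1 (congrArg Subtype.val hy))
    exact ⟨⟨x, hx⟩, Subtype.ext hxy⟩
  · rintro ⟨x, rfl⟩
    exact Subtype.ext (hT.apply_apply_eq_zero x.1)

theorem pieceD_exact [GradedAlgebra 𝒜] (h : IsGradedModule 𝒜 𝒢) [Module.Flat R G] (i : ℕ) :
    Function.Exact (F.pieceD 𝒢 j (i + 1)) (F.pieceD 𝒢 j i) := by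
  have hT := Module.Flat.rTensor_exact G (F.exact_succ i)
  intro y
  constructor
  · intro hy
    obtain ⟨x, hx, hxy⟩ := (F.isInternal_tensorGrading h (i + 2)).exists_mem_of_mem_range
      (F.isInternal_tensorGrading h (i + 1)) (((F.d (i + 1)).rTensor G).restrictScalars k)
      (rTensor_mem_tensorGrading (F.d (i + 1)) (F.d_mem (i + 1))) y.2
      ((hT y.1).1 (congrArg Subtype.val hy))
    exact ⟨⟨x, hx⟩, Subtype.ext hxy⟩
  · rintro ⟨x, rfl⟩
    exact Subtype.ext (hT.apply_apply_eq_zero x.1)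

/-- Tensoring the resolution of `M` with a graded free module of finite rank gives, in degree
zero, a sum of shifts of `M`. -/
theorem nonempty_pieceCoker_finsupp_equiv [IsScalarTower k R M] [GradedAlgebra 𝒜]
    (hℳ : IsGradedModule 𝒜 ℳ)
    {ι : Type*} [Fintype ι] (deg : ι → ℤ) :
    Nonempty (F.PieceCoker (finsuppGrading (intGrading 𝒜) deg) j 0 ≃ₗ[k]
      ((l : ι) → ℳ (j - deg l))) := by
  classical
  have hG := isGradedModule_finsuppGrading (isGradedModule_intGrading 𝒜) deg
  let e : M ⊗[R] (ι →₀ R) ≃ₗ[R] (ι →₀ M) := TensorProduct.finsuppScalarRight R R M ι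
  let t : F.X 0 ⊗[R] (ι →₀ R) →ₗ[k] (ι →₀ M) :=
    (e.toLinearMap ∘ₗ F.ε.rTensor (ι →₀ R)).restrictScalars k
  have ht : ∀ x (f : ι →₀ R) l, t (x ⊗ₜ f) l = f l • F.ε x := fun x f l =>
    TensorProduct.finsuppScalarRight_apply_tmul_apply ..
  have htmem : ∀ x ∈ tensorGrading R (F.grading 0) (finsuppGrading (intGrading 𝒜) deg) j,
      t x ∈ finsuppGrading ℳ deg j := by
    intro x hx
    have : tensorGrading R (F.grading 0) (finsuppGrading (intGrading 𝒜) deg) j ≤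
        (finsuppGrading ℳ deg j).comap t := by
      refine Submodule.span_le.2 ?_
      rintro _ ⟨a, b, y, f, hy, hf, rfl, rfl⟩ l
      rw [ht]
      have := intGrading_smul_mem hℳ (hf l) (F.ε_mem a y hy)
      convert this using 2
      ring
    exact this hx
  let θ : F.Piece (finsuppGrading (intGrading 𝒜) deg) j 0 →ₗ[k] ((l : ι) → ℳ (j - deg l)) :=
    LinearMap.pi fun l => (Finsupp.lapply l ∘ₗ t ∘ₗ Submodule.subtype _).codRestrict _
      fun x => htmem x.1 x.2 l
  have hθ : ∀ x l, (θ x l : M) = t x.1 l := fun _ _ => rfl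
  have hsurj : Function.Surjective θ := by
    intro y
    have hy : ∀ l, ∃ x ∈ F.grading 0 (j - deg l), F.ε x = y l := fun l =>
      (F.isGradedModule 0).isInternal.exists_mem_of_mem_range hℳ.isInternal
        (F.ε.restrictScalars k) F.ε_mem (y l).2 (F.ε_surjective _)
    choose x hx hxy using hy
    refine ⟨⟨∑ l, x l ⊗ₜ Finsupp.single l 1, sum_mem fun l _ =>
      tmul_mem_tensorGrading (hx l) (b := deg l) (fun s => ?_) (by ring)⟩, ?_⟩
    · by_cases hs : l = s
      · subst hs
        rw [sub_self, Finsupp.single_eq_same]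
        have : (1 : R) ∈ intGrading 𝒜 ((0 : ℕ) : ℤ) := by
          rw [intGrading_natCast]; exact SetLike.GradedOne.one_mem
        exact this
      · rw [Finsupp.single_eq_of_ne (Ne.symm hs)]; exact zero_mem _
    · ext l
      rw [hθ]
      simp only [map_sum, Finsupp.finsetSum_apply, ht]
      rw [Finset.sum_eq_single l]
      · simp [hxy]
      · intro s _ hs
        rw [Finsupp.single_eq_of_ne (Ne.symm hs), zero_smul]
      · simp
  have hker : LinearMap.ker θ =
      LinearMap.range (F.pieceD (finsuppGrading (intGrading 𝒜) deg) j 0) := by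
    have hT := rTensor_exact (ι →₀ R) F.exact_zero F.ε_surjective
    apply le_antisymm
    · intro x hx
      have hx' : F.ε.rTensor (ι →₀ R) x.1 = 0 := by
        refine e.map_eq_zero_iff.1 (Finsupp.ext fun l => ?_)
        exact congrArg Subtype.val (congrFun hx l)
      obtain ⟨y, hy, hyx⟩ := (F.isInternal_tensorGrading hG 1).exists_mem_of_mem_range
        (F.isInternal_tensorGrading hG 0) (((F.d 0).rTensor (ι →₀ R)).restrictScalars k)
        (rTensor_mem_tensorGrading (F.d 0) (F.d_mem 0)) x.2 ((hT x.1).1 hx')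
      exact ⟨⟨y, hy⟩, Subtype.ext hyx⟩
    · rintro _ ⟨y, rfl⟩
      ext l
      change e (F.ε.rTensor (ι →₀ R) ((F.d 0).rTensor (ι →₀ R) y.1)) l = 0
      rw [hT.apply_apply_eq_zero, map_zero, Finsupp.zero_apply]
  exact ⟨Submodule.quotEquivOfEq _ _ hker.symm ≪≫ₗ θ.quotKerEquivOfSurjective hsurj⟩

section ShortExact

variable {ι : Type*} [Fintype ι] {deg : ι → ℤ} [GradedAlgebra 𝒜]

theorem subtype_mem_of_mem_subGrading (K : Submodule R N) (j : ℤ) (x : K)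
    (hx : x ∈ subGrading 𝒩 K j) : K.subtype x ∈ 𝒩 j := hx

omit [Fintype ι] in
/-- Dimension shift along a graded presentation `0 → K → G → N → 0` with `G` free. -/
theorem nonempty_torGrading_succ_succ_equiv (h : IsGradedModule 𝒜 𝒩) (π : (ι →₀ R) →ₗ[R] N)
    (hπ : ∀ j, ∀ x ∈ finsuppGrading (intGrading 𝒜) deg j, π x ∈ 𝒩 j)
    (hsurj : Function.Surjective π) (i : ℕ) (j : ℤ) :
    Nonempty (F.torGrading 𝒩 (i + 2) j ≃ₗ[k]
      F.torGrading (subGrading (finsuppGrading (intGrading 𝒜) deg) (LinearMap.ker π))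
        (i + 1) j) := by
  have hG := isGradedModule_finsuppGrading (isGradedModule_intGrading 𝒜) deg
  have hK := isGradedModule_subGrading hG (LinearMap.ker π) (component_mem_ker hG h π hπ)
  have hα := subtype_mem_of_mem_subGrading (𝒩 := finsuppGrading (intGrading 𝒜) deg)
    (LinearMap.ker π)
  have hex : Function.Exact (LinearMap.ker π).subtype π := LinearMap.exact_subtype_ker_map π
  have hle : LinearMap.range (F.pieceD (subGrading (finsuppGrading (intGrading 𝒜) deg)
      (LinearMap.ker π)) j (i + 1)) ≤ (LinearMap.range (F.pieceD _ j (i + 1))).comap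
        (F.pieceMap j _ hα (i + 1)) := by
    rintro _ ⟨x, rfl⟩
    exact ⟨_, (LinearMap.congr_fun (F.pieceMap_comp_pieceD j _ hα (i + 1)) x).symm⟩
  obtain ⟨e₁⟩ := F.nonempty_torGrading_equiv j h (i + 2)
  obtain ⟨e₃⟩ := F.nonempty_torGrading_equiv j hK (i + 1)
  obtain ⟨e₂⟩ := nonempty_homology_equiv_ker
    (F.pieceMap_injective j _ hα (Submodule.subtype_injective _) (i + 1))
    (F.pieceMap_exact j hK hG _ hα π hπ hex hsurj (i + 2))
    (F.pieceMap_exact j hK hG _ hα π hπ hex hsurj (i + 1))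
    (F.pieceMap_surjective j hG h π hπ hsurj (i + 3))
    (F.pieceMap_surjective j hG h π hπ hsurj (i + 2))
    (F.pieceMap_comp_pieceD j _ hα (i + 1)) (F.pieceMap_comp_pieceD j π hπ (i + 1))
    (F.pieceMap_comp_pieceD j π hπ (i + 2)) (F.pieceD_exact j hG (i + 1)) hle
  have heq := ker_mapQ_eq_map_ker
    (F.pieceMap_injective j _ hα (Submodule.subtype_injective _) i)
    (F.pieceMap_comp_pieceD j _ hα i) (F.pieceD_exact j hG i) hle
  exact ⟨e₁ ≪≫ₗ e₂ ≪≫ₗ LinearEquiv.ofEq _ _ heq ≪≫ₗ e₃.symm⟩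

/-- The end `0 → Tor₁(M, N) → M ⊗ K → M ⊗ G → M ⊗ N → 0` of the long exact sequence of a graded
presentation `0 → K → G → N → 0`, in degree `j`. -/
theorem finrank_torGrading_one_add [IsScalarTower k R M] (hℳ : IsGradedModule 𝒜 ℳ)
    [∀ j, FiniteDimensional k (ℳ j)]
    (h : IsGradedModule 𝒜 𝒩) (π : (ι →₀ R) →ₗ[R] N)
    (hπ : ∀ j, ∀ x ∈ finsuppGrading (intGrading 𝒜) deg j, π x ∈ 𝒩 j)
    (hsurj : Function.Surjective π) (j : ℤ) :
    FiniteDimensional k (F.torGrading 𝒩 0 j) ∧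
    Module.finrank k (F.torGrading 𝒩 0 j) ≤ ∑ l, Module.finrank k (ℳ (j - deg l)) ∧
    (FiniteDimensional k (F.torGrading
        (subGrading (finsuppGrading (intGrading 𝒜) deg) (LinearMap.ker π)) 0 j) →
      FiniteDimensional k (F.torGrading 𝒩 1 j) ∧
      Module.finrank k (F.torGrading 𝒩 1 j) ≤ Module.finrank k (F.torGrading
        (subGrading (finsuppGrading (intGrading 𝒜) deg) (LinearMap.ker π)) 0 j) ∧
      Module.finrank k (F.torGrading 𝒩 1 j) + ∑ l, Module.finrank k (ℳ (j - deg l)) =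
        Module.finrank k (F.torGrading
          (subGrading (finsuppGrading (intGrading 𝒜) deg) (LinearMap.ker π)) 0 j) +
          Module.finrank k (F.torGrading 𝒩 0 j)) := by
  have hG := isGradedModule_finsuppGrading (isGradedModule_intGrading 𝒜) deg
  have hK := isGradedModule_subGrading hG (LinearMap.ker π) (component_mem_ker hG h π hπ)
  have hα := subtype_mem_of_mem_subGrading (𝒩 := finsuppGrading (intGrading 𝒜) deg)
    (LinearMap.ker π)
  have hex : Function.Exact (LinearMap.ker π).subtype π := LinearMap.exact_subtype_ker_map π
  have hle : LinearMap.range (F.pieceD (subGrading (finsuppGrading (intGrading 𝒜) deg)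
      (LinearMap.ker π)) j 0) ≤ (LinearMap.range (F.pieceD _ j 0)).comap
        (F.pieceMap j _ hα 0) := by
    rintro _ ⟨x, rfl⟩
    exact ⟨_, (LinearMap.congr_fun (F.pieceMap_comp_pieceD j _ hα 0) x).symm⟩
  obtain ⟨eG⟩ := F.nonempty_pieceCoker_finsupp_equiv j hℳ deg
  have hGfin := Module.Finite.equiv eG.symm
  have hGrank := eG.finrank_eq
  rw [Module.finrank_pi_fintype] at hGrank
  obtain ⟨e₁⟩ := F.nonempty_torGrading_equiv j h 1
  obtain ⟨e₀⟩ := F.nonempty_torGrading_zero_equiv j h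
  obtain ⟨eK⟩ := F.nonempty_torGrading_zero_equiv j hK
  obtain ⟨e₂⟩ := nonempty_homology_equiv_ker
    (F.pieceMap_injective j _ hα (Submodule.subtype_injective _) 0)
    (F.pieceMap_exact j hK hG _ hα π hπ hex hsurj 1)
    (F.pieceMap_exact j hK hG _ hα π hπ hex hsurj 0)
    (F.pieceMap_surjective j hG h π hπ hsurj 2)
    (F.pieceMap_surjective j hG h π hπ hsurj 1)
    (F.pieceMap_comp_pieceD j _ hα 0) (F.pieceMap_comp_pieceD j π hπ 0)
    (F.pieceMap_comp_pieceD j π hπ 1) (F.pieceD_exact j hG 0) hle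
  obtain ⟨h1, h2, h3⟩ := finrank_coker_sequence
    (F.pieceMap_exact j hK hG _ hα π hπ hex hsurj 0)
    (F.pieceMap_surjective j hG h π hπ hsurj 1) (F.pieceMap_surjective j hG h π hπ hsurj 0)
    (F.pieceMap_comp_pieceD j π hπ 0) hle
  rw [hGrank] at h2 h3
  have e := e₁ ≪≫ₗ e₂
  rw [e₀.finrank_eq]
  refine ⟨Module.Finite.equiv e₀.symm, h2, fun hfin => ?_⟩
  have hfinK := Module.Finite.equiv eK
  rw [e.finrank_eq, eK.finrank_eq]
  exact ⟨Module.Finite.equiv e.symm, Submodule.finrank_le _, h3 hfinK⟩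

end ShortExact

end GradedFreeResolution

/-! ### Graded presentations -/

section Presentation

variable {k R N : Type*} [Field k] [CommRing R] [Algebra k R]
  [AddCommGroup N] [Module k N] [Module R N] [IsScalarTower k R N]
  {𝒜 : ℕ → Submodule k R} {𝒩 : ℤ → Submodule k N}

/-- A finitely generated graded module which vanishes below degree `b` has a graded presentation
whose kernel vanishes below degree `b + 1`: take as generators a basis of the component of
degree `b`, and generators of larger degrees. -/
theorem IsGradedModule.exists_graded_presentation [GradedAlgebra 𝒜] (h𝒜 : 𝒜 0 = 1)
    [Algebra.FiniteType k R] [Module.Finite R N] (h : IsGradedModule 𝒜 𝒩) {b : ℤ}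
    (hb : ∀ j < b, 𝒩 j = ⊥) :
    ∃ (ι : Type) (_ : Fintype ι) (deg : ι → ℤ) (π : (ι →₀ R) →ₗ[R] N), (∀ l, b ≤ deg l) ∧
      (∀ j, ∀ x ∈ finsuppGrading (intGrading 𝒜) deg j, π x ∈ 𝒩 j) ∧ Function.Surjective π ∧
      ∀ j < b + 1, subGrading (finsuppGrading (intGrading 𝒜) deg) (LinearMap.ker π) j = ⊥ := by
  classical
  obtain ⟨G, hG𝒩, hG⟩ := h.exists_homogeneous_generators
  have := h.finiteDimensional h𝒜 b
  let G' := G.filter fun p => b < p.1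
  let B := Module.finBasis k (𝒩 b)
  let ι := Fin (Module.finrank k (𝒩 b)) ⊕ Fin (Fintype.card G')
  let g := (Fintype.equivFin G').symm
  let v : ι → N := Sum.elim (fun i => (B i : N)) fun i => (g i).1.2
  let deg : ι → ℤ := Sum.elim (fun _ => b) fun i => (g i).1.1
  have hg : ∀ i, (g i).1 ∈ G ∧ b < (g i).1.1 := fun i => Finset.mem_filter.1 (g i).2
  have hv : ∀ l, v l ∈ 𝒩 (deg l) := by
    rintro (i | i)
    · exact (B i).2
    · exact hG𝒩 _ (hg i).1
  have hdeg : ∀ l, b ≤ deg l := by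
    rintro (i | i)
    · exact le_rfl
    · exact (hg i).2.le
  refine ⟨ι, inferInstance, deg, Finsupp.linearCombination R v, hdeg, ?_, ?_, ?_⟩
  · intro j x hx
    rw [Finsupp.linearCombination_apply]
    refine sum_mem fun l _ => ?_
    have := intGrading_smul_mem h (hx l) (hv l)
    rwa [sub_add_cancel] at this
  · rw [← LinearMap.range_eq_top, Finsupp.range_linearCombination, eq_top_iff, ← hG,
      Submodule.span_le]
    rintro _ ⟨p, hp, rfl⟩
    have hp𝒩 := hG𝒩 p hp
    rcases lt_trichotomy p.1 b with hlt | heq | hgt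
    · rw [hb _ hlt] at hp𝒩
      rw [(Submodule.mem_bot k).1 hp𝒩]
      exact zero_mem _
    · rw [heq] at hp𝒩
      have hsum := congrArg Subtype.val (B.sum_repr ⟨p.2, hp𝒩⟩)
      rw [AddSubmonoidClass.coe_finsetSum] at hsum
      change _ = p.2 at hsum
      rw [SetLike.mem_coe, ← hsum]
      refine sum_mem fun i _ => ?_
      rw [Submodule.coe_smul, ← algebraMap_smul R]
      exact Submodule.smul_mem _ _ (Submodule.subset_span ⟨Sum.inl i, rfl⟩)
    · refine Submodule.subset_span ⟨Sum.inr (g.symm ⟨p, Finset.mem_filter.2 ⟨hp, hgt⟩⟩), ?_⟩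
      simp [v]
  · intro j hj
    rw [eq_bot_iff]
    intro x hx
    -- In degree `b`, only the coordinates at the basis of `𝒩 b` can be nonzero; they are scalars.
    have hneg : ∀ l, j < deg l → x.1 l = 0 := by
      intro l hl
      have := hx l
      rwa [intGrading_of_neg 𝒜 (by omega), Submodule.mem_bot] at this
    have hzero : ∀ l, x.1 l = 0 := by
      rcases lt_or_eq_of_le (Int.lt_add_one_iff.1 hj) with hlt | rfl
      · exact fun l => hneg l (hlt.trans_le (hdeg l))
      · have hr : ∀ i, x.1 (Sum.inr i) = 0 := fun i => hneg _ (hg i).2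
        have hl : ∀ i, ∃ c : k, algebraMap k R c = x.1 (Sum.inl i) := by
          intro i
          have : x.1 (Sum.inl i) ∈ intGrading 𝒜 (j - j) := hx (Sum.inl i)
          rw [sub_self, ← Nat.cast_zero, intGrading_natCast] at this
          exact exists_algebraMap_eq_of_mem_zero h𝒜 this
        choose c hc using hl
        have hx0 : Finsupp.linearCombination R v x.1 = 0 := x.2
        rw [Finsupp.linearCombination_apply,
          Finsupp.sum_fintype _ (fun l a => a • v l) (fun _ => zero_smul _ _),
          Fintype.sum_sum_type] at hx0
        simp only [hr, zero_smul, Finset.sum_const_zero, add_zero, ← hc, algebraMap_smul] at hx0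
        have hcz : ∑ i, c i • B i = 0 := Subtype.ext (by
          rw [AddSubmonoidClass.coe_finsetSum]
          exact hx0)
        have := Fintype.linearIndependent_iff.1 B.linearIndependent c hcz
        rintro (i | i)
        · rw [← hc, this, map_zero]
        · exact hr i
    exact Subtype.ext (Finsupp.ext hzero)

end Presentation

/-! ### Vanishing of Tor and the Euler characteristic -/

section Euler

universe u uR

variable {k : Type*} {R : Type uR} {M : Type*} [Field k] [CommRing R] [Algebra k R]
  [AddCommGroup M] [Module k M] [Module R M] [IsScalarTower k R M]
  {𝒜 : ℕ → Submodule k R} {ℳ : ℤ → Submodule k M} (F : GradedFreeResolution.{w} 𝒜 ℳ)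

namespace GradedFreeResolution

/-- For all finitely generated graded modules `N` in the universe `u` which vanish below some
degree `b`, the components of `Torᵢ(M, N)` are finite dimensional, and vanish in degrees less
than `b₀ + b + i`. The universe is explicit since the passage from `N` to the kernel of a
presentation of `N` leads to the universe of `R`. -/
def TorVanishing (b₀ : ℤ) (i : ℕ) : Prop :=
  ∀ (N : Type u) [AddCommGroup N] [Module k N] [Module R N] [IsScalarTower k R N]
    [Module.Finite R N] (𝒩 : ℤ → Submodule k N) (_ : IsGradedModule 𝒜 𝒩) (b : ℤ)
    (_ : ∀ j < b, 𝒩 j = ⊥) (j : ℤ), FiniteDimensional k (F.torGrading 𝒩 i j) ∧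
      (j < b₀ + b + i → Module.finrank k (F.torGrading 𝒩 i j) = 0)

variable [GradedAlgebra 𝒜] (h𝒜 : 𝒜 0 = 1) [Algebra.FiniteType k R] [Module.Finite R M]
  (hℳ : IsGradedModule 𝒜 ℳ) {b₀ : ℤ} (hb₀ : ∀ j < b₀, ℳ j = ⊥)

include h𝒜 hℳ hb₀

theorem torVanishing_zero : TorVanishing.{w, u} F b₀ 0 := by
  intro N _ _ _ _ _ 𝒩 h b hb j
  have := hℳ.finiteDimensional h𝒜
  obtain ⟨ι, _, deg, π, hdeg, hπ, hsurj, -⟩ := h.exists_graded_presentation h𝒜 hb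
  obtain ⟨h1, h2, -⟩ := F.finrank_torGrading_one_add hℳ h π hπ hsurj j
  refine ⟨h1, fun hj => Nat.le_zero.1 (h2.trans (Finset.sum_eq_zero fun l _ => ?_).le)⟩
  have := hdeg l
  rw [hb₀ _ (by push_cast at hj; omega), finrank_bot]

omit hb₀ in
theorem torVanishing_succ (i : ℕ) (ih : TorVanishing.{w, uR} F b₀ i) :
    TorVanishing.{w, u} F b₀ (i + 1) := by
  intro N _ _ _ _ _ 𝒩 h b hb j
  have : IsNoetherianRing R := Algebra.FiniteType.isNoetherianRing k R
  have := hℳ.finiteDimensional h𝒜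
  obtain ⟨ι, _, deg, π, hdeg, hπ, hsurj, hK⟩ := h.exists_graded_presentation h𝒜 hb
  have hG := isGradedModule_finsuppGrading (isGradedModule_intGrading 𝒜) deg
  have hgr := isGradedModule_subGrading hG (LinearMap.ker π) (component_mem_ker hG h π hπ)
  obtain ⟨hfin, hzero⟩ := ih (LinearMap.ker π) _ hgr (b + 1) hK j
  cases i with
  | zero =>
    obtain ⟨-, -, h3⟩ := F.finrank_torGrading_one_add hℳ h π hπ hsurj j
    obtain ⟨h4, h5, -⟩ := h3 hfin
    refine ⟨h4, fun hj => Nat.le_zero.1 (h5.trans (hzero ?_).le)⟩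
    push_cast at hj ⊢
    omega
  | succ i =>
    obtain ⟨e⟩ := F.nonempty_torGrading_succ_succ_equiv h π hπ hsurj i j
    refine ⟨Module.Finite.equiv e.symm, fun hj => e.finrank_eq.trans (hzero ?_)⟩
    push_cast at hj ⊢
    omega

theorem torVanishing (i : ℕ) : TorVanishing.{w, u} F b₀ i := by
  have h : ∀ i, TorVanishing.{w, uR} F b₀ i := fun i => by
    induction i with
    | zero => exact F.torVanishing_zero h𝒜 hℳ hb₀
    | succ i ih => exact F.torVanishing_succ h𝒜 hℳ i ih
  cases i with
  | zero => exact F.torVanishing_zero h𝒜 hℳ hb₀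
  | succ i => exact F.torVanishing_succ h𝒜 hℳ i (h i)

omit [IsScalarTower k R M] [GradedAlgebra 𝒜] h𝒜 [Algebra.FiniteType k R] [Module.Finite R M] hℳ
  hb₀ in
theorem chiCoeff_eq_sum {N : Type u} [AddCommGroup N] [Module k N] [Module R N]
    [IsScalarTower k R N] {𝒩 : ℤ → Submodule k N} {j : ℤ} {n : ℕ}
    (hn : ∀ i, n ≤ i → Module.finrank k (F.torGrading 𝒩 i j) = 0) :
    chiCoeff F 𝒩 j =
      ∑ i ∈ Finset.range n, (-1) ^ i * (Module.finrank k (F.torGrading 𝒩 i j) : ℤ) := by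
  refine finsum_eq_sum_of_support_subset _ fun i hi => ?_
  rw [Finset.coe_range, Set.mem_Iio]
  by_contra! hni
  exact hi (by simp [hilbertCoeff, hn i hni])

/-- The Euler characteristic is additive along a graded presentation `0 → K → G → N → 0`, and its
value on the free module `G` is a sum of shifts of the Hilbert function of `M`. -/
theorem chiCoeff_add_chiCoeff {N : Type u} [AddCommGroup N] [Module k N] [Module R N]
    [IsScalarTower k R N] [Module.Finite R N] {𝒩 : ℤ → Submodule k N} (h : IsGradedModule 𝒜 𝒩)
    {b : ℤ} (hb : ∀ j < b, 𝒩 j = ⊥) {ι : Type} [Fintype ι] {deg : ι → ℤ}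
    (π : (ι →₀ R) →ₗ[R] N)
    (hπ : ∀ j, ∀ x ∈ finsuppGrading (intGrading 𝒜) deg j, π x ∈ 𝒩 j)
    (hsurj : Function.Surjective π)
    (hK : ∀ j < b + 1, subGrading (finsuppGrading (intGrading 𝒜) deg) (LinearMap.ker π) j = ⊥)
    (j : ℤ) :
    chiCoeff F 𝒩 j +
        chiCoeff F (subGrading (finsuppGrading (intGrading 𝒜) deg) (LinearMap.ker π)) j =
      ∑ l, (Module.finrank k (ℳ (j - deg l)) : ℤ) := by
  have : IsNoetherianRing R := Algebra.FiniteType.isNoetherianRing k R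
  have := hℳ.finiteDimensional h𝒜
  have hG := isGradedModule_finsuppGrading (isGradedModule_intGrading 𝒜) deg
  have hgr := isGradedModule_subGrading hG (LinearMap.ker π) (component_mem_ker hG h π hπ)
  have hN := fun i => F.torVanishing h𝒜 hℳ hb₀ i N 𝒩 h b hb j
  have hN' := fun i => F.torVanishing h𝒜 hℳ hb₀ i (LinearMap.ker π) _ hgr (b + 1) hK j
  let n := (j - b₀ - b + 1).toNat
  rw [F.chiCoeff_eq_sum (n := n + 2) fun i hi => (hN i).2 (by omega),
    F.chiCoeff_eq_sum (n := n + 1) fun i hi => (hN' i).2 (by omega),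
    Finset.sum_range_succ' _ (n + 1), Finset.sum_range_succ' _ n, Finset.sum_range_succ' _ n]
  have hshift : ∀ i, Module.finrank k (F.torGrading 𝒩 (i + 1 + 1) j) = Module.finrank k
      (F.torGrading (subGrading (finsuppGrading (intGrading 𝒜) deg) (LinearMap.ker π))
        (i + 1) j) := by
    intro i
    obtain ⟨e⟩ := F.nonempty_torGrading_succ_succ_equiv h π hπ hsurj i j
    exact e.finrank_eq
  obtain ⟨-, -, h3⟩ := F.finrank_torGrading_one_add hℳ h π hπ hsurj j
  obtain ⟨-, -, h6⟩ := h3 (hN' 0).1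
  have hneg : ∑ i ∈ Finset.range n, (-1 : ℤ) ^ (i + 1 + 1) *
        (Module.finrank k (F.torGrading 𝒩 (i + 1 + 1) j) : ℤ) =
      -∑ i ∈ Finset.range n, (-1 : ℤ) ^ (i + 1) * (Module.finrank k (F.torGrading
        (subGrading (finsuppGrading (intGrading 𝒜) deg) (LinearMap.ker π)) (i + 1) j) : ℤ) := by
    rw [← Finset.sum_neg_distrib]
    refine Finset.sum_congr rfl fun i _ => ?_
    rw [hshift i, pow_succ _ (i + 1)]
    ring
  have h7 : (_ : ℤ) = _ := congrArg (Nat.cast (R := ℤ)) h6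
  push_cast at h7
  rw [hneg]
  simp only [zero_add, pow_zero, pow_one]
  linarith

end GradedFreeResolution

end Euler

/-! ### The Euler characteristic as a product of Hilbert series -/

theorem LaurentSeries.coeff_mul_eq_zero {A B : LaurentSeries ℚ} {a b : ℤ}
    (hA : ∀ j < a, A.coeff j = 0) (hB : ∀ j < b, B.coeff j = 0) {j : ℤ} (hj : j < a + b) :
    (A * B).coeff j = 0 := by
  rw [HahnSeries.coeff_mul]
  refine Finset.sum_eq_zero fun p hp => ?_
  have hp' := (Finset.mem_antidiagonal.1 hp).2.2
  rcases lt_or_ge p.1 a with h | h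
  · rw [hA _ h, zero_mul]
  · rw [hB _ (by omega), mul_zero]

section FreePresentation

variable {k R N : Type*} [Field k] [CommRing R] [Algebra k R]
  [AddCommGroup N] [Module k N] [Module R N] [IsScalarTower k R N]
  {𝒜 : ℕ → Submodule k R} {𝒩 : ℤ → Submodule k N} {ι : Type*} [Fintype ι] {deg : ι → ℤ}

omit [IsScalarTower k R N] [CommRing R] [Algebra k R] [Module R N] in
theorem finrank_finsuppGrading [∀ j, FiniteDimensional k (𝒩 j)] (j : ℤ) :
    Module.finrank k (finsuppGrading 𝒩 deg j) = ∑ l, Module.finrank k (𝒩 (j - deg l)) := by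
  let e : finsuppGrading 𝒩 deg j ≃ₗ[k] ∀ l, 𝒩 (j - deg l) :=
    { toFun := fun f l => ⟨f.1 l, f.2 l⟩
      invFun := fun f => ⟨Finsupp.equivFunOnFinite.symm fun l => (f l : N), fun l => (f l).2⟩
      map_add' := fun _ _ => rfl
      map_smul' := fun _ _ => rfl
      left_inv := fun _ => Subtype.ext (Finsupp.ext fun _ => rfl)
      right_inv := fun _ => rfl }
  rw [e.finrank_eq, Module.finrank_pi_fintype]

/-- The dimension count for a graded presentation `0 → K → G → N → 0` in degree `j`. -/
theorem finrank_add_finrank_ker_of_presentation [GradedAlgebra 𝒜]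
    [∀ j, FiniteDimensional k (intGrading 𝒜 j)] (h : IsGradedModule 𝒜 𝒩)
    (π : (ι →₀ R) →ₗ[R] N)
    (hπ : ∀ j, ∀ x ∈ finsuppGrading (intGrading 𝒜) deg j, π x ∈ 𝒩 j)
    (hsurj : Function.Surjective π) (j : ℤ) :
    Module.finrank k (𝒩 j) + Module.finrank k
        (subGrading (finsuppGrading (intGrading 𝒜) deg) (LinearMap.ker π) j) =
      ∑ l, Module.finrank k (intGrading 𝒜 (j - deg l)) := by
  rw [← finrank_finsuppGrading]
  have hG := isGradedModule_finsuppGrading (isGradedModule_intGrading 𝒜) deg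
  have : FiniteDimensional k (finsuppGrading (intGrading 𝒜) deg j) := by
    let f : finsuppGrading (intGrading 𝒜) deg j →ₗ[k] ∀ l, intGrading 𝒜 (j - deg l) :=
      { toFun := fun f l => ⟨f.1 l, f.2 l⟩
        map_add' := fun _ _ => rfl
        map_smul' := fun _ _ => rfl }
    exact Module.Finite.of_injective f fun x y hxy => Subtype.ext (Finsupp.ext fun l =>
      congrArg Subtype.val (congrFun hxy l))
  let g : finsuppGrading (intGrading 𝒜) deg j →ₗ[k] 𝒩 j :=
    (π.restrictScalars k).restrict (hπ j)
  have hg : Function.Surjective g := by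
    intro y
    obtain ⟨x, hx, hxy⟩ := hG.isInternal.exists_mem_of_mem_range h.isInternal
      (π.restrictScalars k) hπ y.2 (hsurj y)
    exact ⟨⟨x, hx⟩, Subtype.ext hxy⟩
  let e : LinearMap.ker g ≃ₗ[k]
      subGrading (finsuppGrading (intGrading 𝒜) deg) (LinearMap.ker π) j :=
    { toFun := fun m => ⟨⟨m.1.1, congrArg Subtype.val m.2⟩, m.1.2⟩
      invFun := fun m => ⟨⟨m.1.1, m.2⟩, Subtype.ext m.1.2⟩
      map_add' := fun _ _ => rfl
      map_smul' := fun _ _ => rfl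
      left_inv := fun _ => rfl
      right_inv := fun _ => rfl }
  rw [← g.finrank_range_add_finrank_ker, LinearMap.range_eq_top.2 hg, finrank_top, e.finrank_eq]

end FreePresentation

theorem LaurentSeries.coeff_mul_sum_X_zpow {ι : Type*} [Fintype ι] (deg : ι → ℤ)
    (H : LaurentSeries ℚ) (j : ℤ) :
    (H * ∑ l, ((RatFunc.X ^ deg l : RatFunc ℚ) : LaurentSeries ℚ)).coeff j =
      ∑ l, H.coeff (j - deg l) := by
  rw [Finset.mul_sum, HahnSeries.coeff_sum]
  exact Finset.sum_congr rfl fun l _ => by rw [mul_comm, coe_ratFunc_X_zpow_mul_coeff]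

section EulerSeries

universe u uR

variable {k : Type*} {R : Type uR} {M : Type*} [Field k] [CommRing R] [Algebra k R]
  [AddCommGroup M] [Module k M] [Module R M] [IsScalarTower k R M]
  {𝒜 : ℕ → Submodule k R} {ℳ : ℤ → Submodule k M} (F : GradedFreeResolution.{w} 𝒜 ℳ)

namespace GradedFreeResolution

/-- For all finitely generated graded modules `N` in the universe `u` which vanish below some
degree `b`, the series `χ(M, N) · HS_R` and `HS_M · HS_N` agree in degrees less than
`b₀ + b + n`. -/
def EulerSeriesAgree (HR HM : LaurentSeries ℚ) (b₀ : ℤ) (n : ℕ) : Prop :=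
  ∀ (N : Type u) [AddCommGroup N] [Module k N] [Module R N] [IsScalarTower k R N]
    [Module.Finite R N] (𝒩 : ℤ → Submodule k N) (_ : IsGradedModule 𝒜 𝒩) (b : ℤ)
    (_ : ∀ j < b, 𝒩 j = ⊥) (X H : LaurentSeries ℚ) (_ : ∀ j, X.coeff j = chiCoeff F 𝒩 j)
    (_ : IsHilbertSeries 𝒩 H) (j : ℤ), j < b₀ + b + n → (X * HR - HM * H).coeff j = 0

variable [GradedAlgebra 𝒜] (h𝒜 : 𝒜 0 = 1) [Algebra.FiniteType k R] [Module.Finite R M]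
  (hℳ : IsGradedModule 𝒜 ℳ) {b₀ : ℤ} (hb₀ : ∀ j < b₀, ℳ j = ⊥)

include h𝒜 hℳ hb₀

theorem chiCoeff_eq_zero {N : Type u} [AddCommGroup N] [Module k N] [Module R N]
    [IsScalarTower k R N] [Module.Finite R N] {𝒩 : ℤ → Submodule k N} (h : IsGradedModule 𝒜 𝒩)
    {b : ℤ} (hb : ∀ j < b, 𝒩 j = ⊥) {j : ℤ} (hj : j < b₀ + b) : chiCoeff F 𝒩 j = 0 := by
  rw [F.chiCoeff_eq_sum (n := 0) fun i _ =>
    (F.torVanishing h𝒜 hℳ hb₀ i N 𝒩 h b hb j).2 (by omega), Finset.sum_range_zero]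

variable {HR HM : LaurentSeries ℚ} (hHR : IsHilbertSeries (intGrading 𝒜) HR)
  (hHM : IsHilbertSeries ℳ HM)

include hHR hHM

theorem eulerSeriesAgree_zero : EulerSeriesAgree.{w, u} F HR HM b₀ 0 := by
  intro N _ _ _ _ _ 𝒩 h b hb X H hX hH j hj
  rw [Nat.cast_zero, add_zero] at hj
  have hR : ∀ j < 0, HR.coeff j = 0 := fun j hj => by
    rw [hHR, intGrading_of_neg 𝒜 hj, finrank_bot, Nat.cast_zero]
  rw [HahnSeries.coeff_sub, LaurentSeries.coeff_mul_eq_zero (a := b₀ + b) (b := 0)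
    (fun i hi => by rw [hX, F.chiCoeff_eq_zero h𝒜 hℳ hb₀ h hb hi, Int.cast_zero]) hR (by omega),
    LaurentSeries.coeff_mul_eq_zero (a := b₀) (b := b)
      (fun i hi => by rw [hHM, hb₀ i hi, finrank_bot, Nat.cast_zero])
      (fun i hi => by rw [hH, hb i hi, finrank_bot, Nat.cast_zero]) hj, sub_zero]

/-- Along a graded presentation `0 → K → G → N → 0`, both series are additive, and they are equal
for the free module `G`; moreover `K` vanishes in one more degree than `N`. -/
theorem eulerSeriesAgree_succ (n : ℕ) (ih : EulerSeriesAgree.{w, uR} F HR HM b₀ n) :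
    EulerSeriesAgree.{w, u} F HR HM b₀ (n + 1) := by
  intro N _ _ _ _ _ 𝒩 h b hb X H hX hH j hj
  have : IsNoetherianRing R := Algebra.FiniteType.isNoetherianRing k R
  have := (isGradedModule_intGrading 𝒜).finiteDimensional h𝒜
  obtain ⟨ι, _, deg, π, hdeg, hπ, hsurj, hK⟩ := h.exists_graded_presentation h𝒜 hb
  have hG := isGradedModule_finsuppGrading (isGradedModule_intGrading 𝒜) deg
  have hgr := isGradedModule_subGrading hG (LinearMap.ker π) (component_mem_ker hG h π hπ)
  obtain ⟨H', hH'⟩ := exists_isHilbertSeries hK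
  obtain ⟨X', hX'⟩ := exists_laurentSeries_of_eq_zero
    (fun j => (chiCoeff F (subGrading (finsuppGrading (intGrading 𝒜) deg) (LinearMap.ker π)) j : ℚ))
    (b₀ + (b + 1)) fun i hi => by rw [F.chiCoeff_eq_zero h𝒜 hℳ hb₀ hgr hK hi, Int.cast_zero]
  let p : LaurentSeries ℚ := ∑ l, ((RatFunc.X ^ deg l : RatFunc ℚ) : LaurentSeries ℚ)
  have h1 : X + X' = HM * p := by
    ext i
    rw [HahnSeries.coeff_add, LaurentSeries.coeff_mul_sum_X_zpow, hX, hX', ← Int.cast_add,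
      F.chiCoeff_add_chiCoeff h𝒜 hℳ hb₀ h hb π hπ hsurj hK i, Int.cast_sum]
    exact Finset.sum_congr rfl fun l _ => by rw [hHM, Int.cast_natCast]
  have h2 : H + H' = HR * p := by
    ext i
    rw [HahnSeries.coeff_add, LaurentSeries.coeff_mul_sum_X_zpow, hH, hH', ← Nat.cast_add,
      finrank_add_finrank_ker_of_presentation h π hπ hsurj i, Nat.cast_sum]
    exact Finset.sum_congr rfl fun l _ => by rw [hHR]
  have h3 : X * HR - HM * H = -(X' * HR - HM * H') := by
    linear_combination HR * h1 - HM * h2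
  rw [h3, HahnSeries.coeff_neg, ih _ _ hgr _ hK X' H' hX' hH' j (by push_cast at hj; omega),
    neg_zero]

/-- `χ(M, N) · HS_R = HS_M · HS_N`. -/
theorem eulerSeries_mul {N : Type u} [AddCommGroup N] [Module k N] [Module R N]
    [IsScalarTower k R N] [Module.Finite R N] {𝒩 : ℤ → Submodule k N} (h : IsGradedModule 𝒜 𝒩)
    {X H : LaurentSeries ℚ} (hX : ∀ j, X.coeff j = chiCoeff F 𝒩 j) (hH : IsHilbertSeries 𝒩 H) :
    X * HR = HM * H := by
  have hagree : ∀ n, EulerSeriesAgree.{w, uR} F HR HM b₀ n := fun n => by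
    induction n with
    | zero => exact F.eulerSeriesAgree_zero h𝒜 hℳ hb₀ hHR hHM
    | succ n ih => exact F.eulerSeriesAgree_succ h𝒜 hℳ hb₀ hHR hHM n ih
  obtain ⟨b, hb⟩ := h.exists_eq_bot_of_lt h𝒜
  rw [← sub_eq_zero]
  ext j
  exact F.eulerSeriesAgree_succ h𝒜 hℳ hb₀ hHR hHM _ (hagree (j - b₀ - b).toNat) N 𝒩 h b hb X H
    hX hH j (by push_cast; omega)

end GradedFreeResolution

end EulerSeries

end

theorem theorem1 {k R M N : Type*} [Field k] [CommRing R] [Nontrivial R] [Algebra k R]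
    (𝒜 : ℕ → Submodule k R) [GradedAlgebra 𝒜] (h𝒜 : 𝒜 0 = 1) [Algebra.FiniteType k R]
    [AddCommGroup M] [Module k M] [Module R M] [IsScalarTower k R M]
    [Nontrivial M] [Module.Finite R M]
    (ℳ : ℤ → Submodule k M) (hℳ : IsGradedModule 𝒜 ℳ)
    [AddCommGroup N] [Module k N] [Module R N] [IsScalarTower k R N]
    [Nontrivial N] [Module.Finite R N]
    (𝒩 : ℤ → Submodule k N) (h𝒩 : IsGradedModule 𝒜 𝒩) :
    ∃ (m n r : ℕ) (e : RatFunc ℚ),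
      Module.supportDim R M = m ∧ Module.supportDim R N = n ∧ ringKrullDim R = r ∧
      e.denom.eval 1 ≠ 0 ∧ 0 < e.eval (RingHom.id ℚ) 1 ∧
      ∀ F : GradedFreeResolution.{w} 𝒜 ℳ,
        (∀ i j, FiniteDimensional k (F.torGrading 𝒩 i j)) ∧
        (∃ b : ℤ, ∀ i, ∀ j < b, F.torGrading 𝒩 i j = ⊥) ∧
        (∀ j, {i | F.torGrading 𝒩 i j ≠ ⊥}.Finite) ∧
        ∀ j : ℤ, (chiCoeff F 𝒩 j : ℚ) =
          (((1 / (1 - RatFunc.X) ^ ((m : ℤ) + n - r) * e : RatFunc ℚ)) :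
            LaurentSeries ℚ).coeff j := by
  have hR := isGradedModule_intGrading 𝒜
  obtain ⟨m, eM, hm, heM, hHM⟩ := hℳ.exists_hilbertSeries_eq h𝒜
  obtain ⟨n, eN, hn, heN, hHN⟩ := h𝒩.exists_hilbertSeries_eq h𝒜
  obtain ⟨r, eR, hr, heR, hHR⟩ := hR.exists_hilbertSeries_eq h𝒜
  obtain ⟨bM, hbM⟩ := hℳ.exists_eq_bot_of_lt h𝒜
  obtain ⟨bN, hbN⟩ := h𝒩.exists_eq_bot_of_lt h𝒜
  obtain ⟨HM, hHM'⟩ := exists_isHilbertSeries hbM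
  obtain ⟨HN, hHN'⟩ := exists_isHilbertSeries hbN
  obtain ⟨HR, hHR'⟩ := exists_isHilbertSeries fun j hj => intGrading_of_neg 𝒜 (j := j) hj
  rw [Module.supportDim_self_eq_ringKrullDim] at hr
  obtain ⟨hden, hpos⟩ := ((heM.mul heN).div heR).denom_ne_zero_and_eval_pos
  refine ⟨m, n, r, eM * eN / eR, hm, hn, hr, hden, hpos, fun F => ?_⟩
  have hTor := fun i j => F.torVanishing h𝒜 hℳ hbM i N 𝒩 h𝒩 bN hbN j
  have hbot : ∀ (i : ℕ) (j : ℤ), j < bM + bN + i → F.torGrading 𝒩 i j = ⊥ := fun i j hj => by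
    have := (hTor i j).1
    exact Submodule.finrank_eq_zero.1 ((hTor i j).2 hj)
  refine ⟨fun i j => (hTor i j).1, ⟨bM + bN, fun i j hj => hbot i j (by omega)⟩, fun j => ?_,
    fun j => ?_⟩
  · refine (Set.finite_Iic (j - bM - bN).toNat).subset fun i hi => ?_
    rw [Set.mem_Iic]
    by_contra! hlt
    exact hi (hbot i j (by omega))
  · obtain ⟨X, hX⟩ := exists_laurentSeries_of_eq_zero (fun j => (chiCoeff F 𝒩 j : ℚ)) (bM + bN)
      fun i hi => by rw [F.chiCoeff_eq_zero h𝒜 hℳ hbM h𝒩 hbN hi, Int.cast_zero]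
    have hmul := F.eulerSeries_mul h𝒜 hℳ hbM hHR' hHM' h𝒩 hX hHN'
    have h1X := one_sub_X_ne_zero
    have hfR : eR / (1 - RatFunc.X) ^ r ≠ 0 := div_ne_zero heR.ne_zero (pow_ne_zero _ h1X)
    rw [hHM HM hHM', hHN HN hHN', hHR HR hHR', ← map_mul, ← eq_div_iff ((map_ne_zero _).2 hfR),
      ← map_div₀] at hmul
    rw [← hX j, hmul]
    congr 2
    have := heR.ne_zero
    rw [zpow_sub₀ h1X, zpow_add₀ h1X, zpow_natCast, zpow_natCast, zpow_natCast]
    field_simp
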